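/- Let $\mathbf k$ be a field of characteristic zero. For $n\ge 2$ let $\mathrm{Br}_n$ be the set of full bracketings of $n$ symbols $\bullet$ (the vertices of the Stasheff associahedron $K_n$), partially ordered by the order $\prec$ generated by $u\prec v$ whenever $v$ arises from $u$ by one substitution $(w_1w_2)w_3\mapsto w_1(w_2w_3)$ of a sub-bracketing, and let $\xi_n=(\cdots((\bullet\bullet)\bullet)\cdots)\bullet$ be its minimal element. For $u\in\mathrm{Br}_a$, $v\in\mathrm{Br}_b$ and $1\le t\le b$ let $\iota_t(u,v)=(u,v)_t\in\mathrm{Br}_{a+b-1}$ be the bracketing obtained by inserting $(u)$ at the $t$-th symbol of $v$. The canonical triangulation $T_n$ of $K_n$ is defined inductively: $T_2$ is the point $\bullet\bullet$, and $T_n$ is the cone with apex $\xi_n$ over the union of the complexes $\iota_t(T_a\times T_b)$ with $a+b=n+1$, $a,b\ge 2$, $2\le t\le b$, where $T_a\times T_b$ carries the product triangulation (its faces are the finite non-empty chains for the product order whose two projections are faces of $T_a$ and $T_b$). The faces of $T_n$ are totally ordered by $\prec$ and are oriented by this order, and $\iota_t$ is a simplicial map $T_a\times T_b\to T_{a+b-1}$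 for all $1\le t\le b$. Let $C_p(K_n)$ be the space of oriented simplicial $p$-chains of $T_n$ with coefficients in $\mathbf k$, and let $d_S$ be the simplicial differential. For $\mathbf s\in C_p(K_a)$ and $\mathbf t\in C_q(K_b)$ put $$\mathbf s\diamond_t\mathbf t:=(\iota_t)_*(\mathbf s\times\mathbf t)\in C_{p+q}(K_{a+b-1})\quad(1\le t\le b),\qquad \mathbf s\diamond\mathbf t:=\sum_{1\le t\le b}(-1)^{(a+1)(t+q+1)}\,\mathbf s\diamond_t\mathbf t,$$ where $\times$ is the simplicial (shuffle) cross product. Let $C(K)^m:=\bigoplus_{n-p-1=m}C_p(K_n)$, write $|\mathbf s|=a-p-1$ for $\mathbf s\in C_p(K_a)$, and extend $$[\mathbf s,\mathbf t]:=\mathbf s\diamond\mathbf t-(-1)^{|\mathbf s||\mathbf t|}\,\mathbf t\diamond\mathbf s$$ bilinearly to $C(K)^*$. Then $(C(K)^*,[-,-],d_S)$ is a differential graded Lie algebra: the bracket has degree $0$ and $d_S$ has degree $1$, $d_S^2=0$, and for homogeneous $x,y,z$ $$[x,y]=-(-1)^{|x||y|}[y,x],\qquad [x,[y,z]]=[[x,y],z]+(-1)^{|x||y|}[y,[x,z]],\qquad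 d_S[x,y]=[d_Sx,y]+(-1)^{|x|}[x,d_Sy].$$ -/

import Mathlib

open scoped DirectSum

namespace Associahedron

/-! ### Full bracketings -/

/-- Full bracketings of strings of a symbol `•`; those of `n` symbols are the `u` with
`u.length = n`, and they are the vertices of the associahedron `K_n`. -/
abbrev Bracketing : Type := FreeMagma Unit

theorem mul_inj' {u v u' v' : Bracketing} (h : u * v = u' * v') : u = u' ∧ v = v' := by
  change FreeMagma.mul u v = FreeMagma.mul u' v' at h
  injection h with h1 h2
  exact ⟨h1, h2⟩

/-- One substitution `(w₁ w₂) w₃ ↦ w₁ (w₂ w₃)` at some place of a bracketing. -/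
inductive Step : Bracketing → Bracketing → Prop
  | assoc (w₁ w₂ w₃ : Bracketing) : Step ((w₁ * w₂) * w₃) (w₁ * (w₂ * w₃))
  | left {u u' : Bracketing} (v : Bracketing) : Step u u' → Step (u * v) (u' * v)
  | right (u : Bracketing) {v v' : Bracketing} : Step v v' → Step (u * v) (u * v')

/-- A weight that every substitution increases; it shows that `≺` is antisymmetric. -/
def weight : Bracketing → ℕ
  | FreeMagma.of _ => 0
  | FreeMagma.mul u v => weight u + weight v + v.length

theorem weight_mul (u v : Bracketing) : weight (u * v) = weight u + weight v + v.length := rfl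

theorem length_mul' (u v : Bracketing) : (u * v).length = u.length + v.length := rfl

theorem Step.length_eq {u v : Bracketing} (h : Step u v) : u.length = v.length := by
  induction h with
  | assoc w₁ w₂ w₃ => simp only [length_mul']; omega
  | left v _ ih => simp only [length_mul']; omega
  | right u _ ih => simp only [length_mul']; omega

theorem Step.weight_lt {u v : Bracketing} (h : Step u v) : weight u < weight v := by
  induction h with
  | assoc w₁ w₂ w₃ =>
    have := w₃.length_pos
    simp only [weight_mul, length_mul']; omega
  | left v _ ih => simp only [weight_mul]; omega
  | right u h ih =>
    have := h.length_eq
    simp only [weight_mul]; omega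

theorem eq_or_weight_lt {u v : Bracketing} (h : Relation.ReflTransGen Step u v) :
    u = v ∨ weight u < weight v := by
  induction h with
  | refl => exact Or.inl rfl
  | tail _ h ih =>
    have := h.weight_lt
    rcases ih with rfl | ih
    · exact Or.inr this
    · exact Or.inr (ih.trans this)

/-- The partial order `≺` on bracketings that is generated by the substitutions
`(w₁ w₂) w₃ ↦ w₁ (w₂ w₃)`. -/
instance : PartialOrder Bracketing where
  le := Relation.ReflTransGen Step
  le_refl _ := Relation.ReflTransGen.refl
  le_trans _ _ _ h₁ h₂ := h₁.trans h₂
  le_antisymm u v h₁ h₂ := by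
    rcases eq_or_weight_lt h₁ with h | h
    · exact h
    · rcases eq_or_weight_lt h₂ with h' | h'
      · exact h'.symm
      · omega

theorem Step.le {u v : Bracketing} (h : Step u v) : u ≤ v := Relation.ReflTransGen.single h

theorem length_eq_of_le {u v : Bracketing} (h : u ≤ v) : u.length = v.length := by
  change Relation.ReflTransGen Step u v at h
  induction h with
  | refl => rfl
  | tail _ h ih => exact ih.trans h.length_eq

theorem le_of_forall_step {f : Bracketing → Bracketing}
    (hf : ∀ u v, Step u v → f u ≤ f v) : Monotone f := by
  intro u v h
  change Relation.ReflTransGen Step u v at h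
  induction h with
  | refl => exact le_rfl
  | tail _ h ih => exact ih.trans (hf _ _ h)

theorem mul_mono {u u' v v' : Bracketing} (h : u ≤ u') (h' : v ≤ v') : u * v ≤ u' * v' :=
  le_trans (le_of_forall_step (f := fun x => x * v) (fun _ _ s => (Step.left v s).le) h)
    (le_of_forall_step (f := fun x => u' * x) (fun _ _ s => (Step.right u' s).le) h')

/-- The bracketing `ξ_n = (⋯((• •) •)⋯) •` of `n ≥ 1` symbols. -/
def xi : ℕ → Bracketing
  | 0 => FreeMagma.of ()
  | 1 => FreeMagma.of ()
  | n + 2 => xi (n + 1) * FreeMagma.of ()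

theorem xi_succ {n : ℕ} (hn : 1 ≤ n) : xi (n + 1) = xi n * FreeMagma.of () := by
  cases n with
  | zero => omega
  | succ n => rfl

theorem length_xi {n : ℕ} (hn : 1 ≤ n) : (xi n).length = n := by
  induction n, hn using Nat.le_induction with
  | base => rfl
  | succ n hn ih => rw [xi_succ hn, length_mul', ih]; rfl

theorem xi_add_le (a b : ℕ) (ha : 1 ≤ a) (hb : 1 ≤ b) : xi (a + b) ≤ xi a * xi b := by
  induction b, hb using Nat.le_induction with
  | base => exact (xi_succ ha).le
  | succ b hb ih =>
    rw [← add_assoc, xi_succ (by omega), xi_succ hb]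
    exact (mul_mono ih le_rfl).trans (Step.assoc _ _ _).le

theorem xi_le (u : Bracketing) : xi u.length ≤ u := by
  induction u using FreeMagma.recOnMul with
  | ih1 x => exact le_rfl
  | ih2 u v hu hv =>
    exact (xi_add_le _ _ u.length_pos v.length_pos).trans (mul_mono hu hv)

/-- `ξ_n` is the minimal element of the set of bracketings of `n` symbols. -/
theorem isLeast_xi {n : ℕ} (hn : 1 ≤ n) : IsLeast {u : Bracketing | u.length = n} (xi n) :=
  ⟨length_xi hn, fun u hu => by rw [← show u.length = n from hu]; exact xi_le u⟩

theorem eq_xi_of_le {n : ℕ} (hn : 1 ≤ n) {u : Bracketing} (h : u ≤ xi n) : u = xi n := by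
  have hl : u.length = n := (length_eq_of_le h).trans (length_xi hn)
  exact le_antisymm h ((isLeast_xi hn).2 hl)

/-- `graft t u v = (u, v)_t` inserts `(u)` at the `t`-th symbol of `v`, `1 ≤ t ≤ v.length`
(a `t` outside of this range is moved to its nearest end). -/
def graft (t : ℕ) (u : Bracketing) : Bracketing → Bracketing
  | FreeMagma.of _ => u
  | FreeMagma.mul l r => if t ≤ l.length then graft t u l * r else l * graft (t - l.length) u r

theorem graft_of (t : ℕ) (u : Bracketing) (x : Unit) : graft t u (FreeMagma.of x) = u := rfl

theorem graft_mul (t : ℕ) (u l r : Bracketing) :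
    graft t u (l * r) = if t ≤ l.length then graft t u l * r else l * graft (t - l.length) u r :=
  rfl

theorem length_graft (t : ℕ) (u v : Bracketing) :
    (graft t u v).length + 1 = u.length + v.length := by
  induction v using FreeMagma.recOnMul generalizing t with
  | ih1 x => rfl
  | ih2 l r hl hr =>
    rw [graft_mul]
    split_ifs
    · have := hl t
      simp only [length_mul']; omega
    · have := hr (t - l.length)
      simp only [length_mul']; omega

theorem graft_mono_left (t : ℕ) (v : Bracketing) : Monotone fun u => graft t u v := by
  induction v using FreeMagma.recOnMul generalizing t with
  | ih1 x => exact fun _ _ h => h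
  | ih2 l r hl hr =>
    intro u u' h
    simp only [graft_mul]
    split_ifs
    · exact mul_mono (hl t h) le_rfl
    · exact mul_mono le_rfl (hr _ h)

theorem graft_mono_right (t : ℕ) (u : Bracketing) : Monotone (graft t u) := by
  refine le_of_forall_step fun v v' h => ?_
  induction h generalizing t with
  | assoc w₁ w₂ w₃ =>
    simp only [graft_mul, length_mul', Nat.sub_le_iff_le_add]
    by_cases h₁ : t ≤ w₁.length
    · simp only [h₁, show t ≤ w₁.length + w₂.length by omega, if_true]
      exact (Step.assoc _ _ _).le
    · by_cases h₂ : t ≤ w₁.length + w₂.length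
      · simp only [h₁, h₂, show t ≤ w₂.length + w₁.length by omega, if_true, if_false]
        exact (Step.assoc _ _ _).le
      · simp only [h₁, h₂, show ¬ t ≤ w₂.length + w₁.length by omega, if_false]
        rw [Nat.sub_sub]
        exact (Step.assoc _ _ _).le
  | left v h ih =>
    simp only [graft_mul, h.length_eq]
    split_ifs
    · exact mul_mono (ih t) le_rfl
    · exact mul_mono h.le le_rfl
  | right w h ih =>
    simp only [graft_mul]
    split_ifs
    · exact mul_mono le_rfl h.le
    · exact mul_mono le_rfl (ih _)

/-- The map `ι_t : (u, v) ↦ (u, v)_t` on vertices. -/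
def iota (t : ℕ) (x : Bracketing × Bracketing) : Bracketing := graft t x.1 x.2

theorem iota_mono (t : ℕ) : Monotone (iota t) := fun x y h =>
  (graft_mono_left t x.2 h.1).trans (graft_mono_right t y.1 h.2)

theorem graft_inj (t : ℕ) {u u' v v' : Bracketing} (hu : u.length = u'.length)
    (hv : v.length = v'.length) (h : graft t u v = graft t u' v') : u = u' ∧ v = v' := by
  induction v using FreeMagma.recOnMul generalizing t v' with
  | ih1 x =>
    cases v' with
    | of x' => exact ⟨h, rfl⟩
    | mul l' r' =>
      have h1 := l'.length_pos
      have h2 := r'.length_pos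
      change 1 = l'.length + r'.length at hv
      omega
  | ih2 l r hl hr =>
    cases v' with
    | of x' =>
      have h1 := l.length_pos
      have h2 := r.length_pos
      change l.length + r.length = 1 at hv
      omega
    | mul l' r' =>
      change l.length + r.length = l'.length + r'.length at hv
      change graft t u (l * r) = graft t u' (l' * r') at h
      rw [graft_mul, graft_mul] at h
      have hup := u.length_pos
      split_ifs at h with h1 h2 h2
      · obtain ⟨e1, rfl⟩ := mul_inj' h
        obtain ⟨e, rfl⟩ := hl t (by omega) e1
        exact ⟨e, rfl⟩
      · obtain ⟨e1, _⟩ := mul_inj' h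
        have := length_graft t u l
        rw [e1] at this
        omega
      · obtain ⟨e1, _⟩ := mul_inj' h
        have := length_graft t u' l'
        rw [← e1] at this
        omega
      · obtain ⟨rfl, e1⟩ := mul_inj' h
        obtain ⟨e, rfl⟩ := hr _ (by omega) e1
        exact ⟨e, rfl⟩

theorem graft_zero (u v : Bracketing) : graft 0 u v = graft 1 u v := by
  induction v using FreeMagma.recOnMul with
  | ih1 x => rfl
  | ih2 l r hl hr =>
    have := l.length_pos
    rw [graft_mul, graft_mul, if_pos (Nat.zero_le _), if_pos (by omega), hl]

theorem graft_big {t : ℕ} (u : Bracketing) {v : Bracketing} (ht : v.length ≤ t) :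
    graft t u v = graft v.length u v := by
  induction v using FreeMagma.recOnMul generalizing t with
  | ih1 x => rfl
  | ih2 l r hl hr =>
    have := r.length_pos
    rw [length_mul'] at ht ⊢
    rw [graft_mul, graft_mul, if_neg (by omega), if_neg (by omega), hr (by omega),
      Nat.add_sub_cancel_left]

theorem graft_one_mul (u l r : Bracketing) : graft 1 u (l * r) = graft 1 u l * r := by
  rw [graft_mul, if_pos (Nat.succ_le_of_lt l.length_pos)]

/-- Insertion at the first place of an outcome of insertion, nested case. -/
theorem graft_one_graft (s : ℕ) (x y z : Bracketing) (hs : s ≤ y.length) :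
    graft 1 (graft s x y) z = graft s x (graft 1 y z) := by
  induction z using FreeMagma.recOnMul with
  | ih1 _ => rfl
  | ih2 l r hl hr =>
    have h1 := length_graft 1 y l
    have h2 := l.length_pos
    rw [graft_one_mul, graft_one_mul, graft_mul, if_pos (by omega), hl]

/-- Insertion at the first place of an outcome of insertion, disjoint case. -/
theorem graft_one_disjoint (j : ℕ) (x y z : Bracketing) (hj : 2 ≤ j) (hz : j ≤ z.length) :
    graft 1 x (graft j y z) = graft (j + x.length - 1) y (graft 1 x z) := by
  induction z using FreeMagma.recOnMul generalizing j with
  | ih1 _ => change j ≤ 1 at hz; omega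
  | ih2 l r hl hr =>
    have h1 := length_graft 1 x l
    have h2 := l.length_pos
    have h3 := x.length_pos
    rw [graft_mul, graft_one_mul, graft_mul]
    by_cases h : j ≤ l.length
    · rw [if_pos h, if_pos (by omega), graft_one_mul, hl j hj h]
    · rw [if_neg h, if_neg (by omega), graft_one_mul]
      congr 2
      omega

/-! ### Simplicial complexes with ordered vertices and their chains -/

section Complexes

variable {V W : Type} [DecidableEq V] [DecidableEq W]

/-- The cone over `X` with apex `v`. -/
def cone (X : PreAbstractSimplicialComplex V) (v : V) : PreAbstractSimplicialComplex V where
  faces := {σ | σ.Nonempty ∧ (σ.erase v = ∅ ∨ σ.erase v ∈ X)}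
  isRelLowerSet_faces := by
    rintro σ ⟨hσ, h⟩
    refine ⟨hσ, fun τ hτσ hτ => ⟨hτ, ?_⟩⟩
    have hsub : τ.erase v ⊆ σ.erase v := Finset.erase_subset_erase v hτσ
    rcases Finset.eq_empty_or_nonempty (τ.erase v) with h' | h'
    · exact Or.inl h'
    · rcases h with h | h
      · rw [h] at hsub
        exact Or.inl (Finset.subset_empty.mp hsub)
      · exact Or.inr ((X.isRelLowerSet_faces h).2 hsub h')

/-- The product triangulation: a face of the product of two complexes with ordered vertices is a
chain for the product order whose projections are faces of the factors. -/
def ordProd [PartialOrder V] [PartialOrder W] (X : PreAbstractSimplicialComplex V)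
    (Y : PreAbstractSimplicialComplex W) : PreAbstractSimplicialComplex (V × W) where
  faces := {σ | IsChain (· ≤ ·) (σ : Set (V × W)) ∧
    σ.image Prod.fst ∈ X ∧ σ.image Prod.snd ∈ Y}
  isRelLowerSet_faces := by
    rintro σ ⟨hc, hX, hY⟩
    refine ⟨Finset.image_nonempty.mp (X.isRelLowerSet_faces hX).1, fun τ hτσ hτ => ?_⟩
    exact ⟨hc.mono (Finset.coe_subset.mpr hτσ),
      (X.isRelLowerSet_faces hX).2 (Finset.image_subset_image hτσ) (hτ.image _),
      (Y.isRelLowerSet_faces hY).2 (Finset.image_subset_image hτσ) (hτ.image _)⟩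

/-- The `p`-simplices of `X`, oriented by the order of the vertices: `v₀ < ⋯ < v_p` spanning a face
of `X`. -/
def OSimplex [PartialOrder V] (X : PreAbstractSimplicialComplex V) (p : ℕ) : Type :=
  {v : Fin (p + 1) → V // StrictMono v ∧ Finset.univ.image v ∈ X}

/-- The oriented simplicial `p`-chains of `X` with coefficients in `k`. -/
abbrev Chain (k : Type*) [Field k] [PartialOrder V] (X : PreAbstractSimplicialComplex V) (p : ℕ) :
    Type _ :=
  OSimplex X p →₀ k

/-- The face of an oriented simplex opposite to its `i`-th vertex. -/
def OSimplex.face [PartialOrder V] {X : PreAbstractSimplicialComplex V} {p : ℕ}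
    (v : OSimplex X (p + 1)) (i : Fin (p + 2)) : OSimplex X p :=
  ⟨v.1 ∘ i.succAbove, v.2.1.comp (Fin.strictMono_succAbove i),
    (X.isRelLowerSet_faces v.2.2).2
      (by
        intro x hx
        obtain ⟨j, -, rfl⟩ := Finset.mem_image.mp hx
        exact Finset.mem_image_of_mem _ (Finset.mem_univ _))
      (Finset.univ_nonempty.image _)⟩

variable (k : Type*) [Field k]

/-- The simplicial boundary `[v₀, …, v_{p+1}] ↦ ∑ (-1)^i [v₀, …, v̂_i, …, v_{p+1}]`. -/
noncomputable def boundary [PartialOrder V] (X : PreAbstractSimplicialComplex V) (p : ℕ) :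
    Chain k X (p + 1) →ₗ[k] Chain k X p :=
  Finsupp.linearCombination k fun v : OSimplex X (p + 1) =>
    ∑ i : Fin (p + 2), (-1 : k) ^ (i : ℕ) • Finsupp.single (v.face i) (1 : k)

/-- The map on chains of a map that is monotone on vertices and takes faces to faces; simplices
with a degenerate image go to `0`. -/
noncomputable def pushforward [PartialOrder V] [PartialOrder W]
    {X : PreAbstractSimplicialComplex V} {Y : PreAbstractSimplicialComplex W} (f : V → W)
    (_hmono : Monotone f) (hface : ∀ σ ∈ X, σ.image f ∈ Y) (p : ℕ) :
    Chain k X p →ₗ[k] Chain k Y p :=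
  open Classical in
  Finsupp.linearCombination k fun v : OSimplex X p =>
    if h : StrictMono (f ∘ v.1) then
      Finsupp.single (⟨f ∘ v.1, h, by
        rw [← Finset.image_image]
        exact hface _ v.2.2⟩ : OSimplex Y p) (1 : k)
    else 0

end Complexes

/-! ### Shuffles and the simplicial cross product -/

/-- A `(p, q)`-shuffle, given by the part `i₁ < ⋯ < i_p` of a partition of `p + q` (here
`{0, …, p + q - 1}`) into a part with `p` and a part with `q` elements. -/
abbrev Shuffle (p q : ℕ) : Type := {I : Finset (Fin (p + q)) // I.card = p}

namespace Shuffle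

variable {p q : ℕ} (φ : Shuffle p q)

/-- The signum of the permutation `(1, …, p + q) ↦ (i₁, …, i_p, j₁, …, j_q)`, by its inversions. -/
def sgn : ℤ :=
  (-1) ^ ((Finset.univ : Finset (Fin (p + q) × Fin (p + q))).filter
    (fun x => x.1 ∈ φ.1 ∧ x.2 ∉ φ.1 ∧ x.2 < x.1)).card

/-- `φ'(l)`, the number of the first `l` elements that lie in the part `i₁ < ⋯ < i_p`. -/
def fst (l : Fin (p + q + 1)) : Fin (p + 1) :=
  ⟨(φ.1.filter fun x : Fin (p + q) => (x : ℕ) < l).card,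
    Nat.lt_succ_of_le ((Finset.card_filter_le _ _).trans φ.2.le)⟩

/-- `φ''(l)`, the number of the first `l` elements that lie in the part `j₁ < ⋯ < j_q`. -/
def snd (l : Fin (p + q + 1)) : Fin (q + 1) :=
  ⟨(φ.1ᶜ.filter fun x : Fin (p + q) => (x : ℕ) < l).card,
    Nat.lt_succ_of_le ((Finset.card_filter_le _ _).trans (by
      rw [Finset.card_compl, φ.2, Fintype.card_fin]; omega))⟩

theorem fst_mono : Monotone φ.fst := fun l m h => by
  refine Fin.mk_le_mk.mpr (Finset.card_le_card fun x hx => ?_)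
  rw [Finset.mem_filter] at hx ⊢
  exact ⟨hx.1, hx.2.trans_le h⟩

theorem snd_mono : Monotone φ.snd := fun l m h => by
  refine Fin.mk_le_mk.mpr (Finset.card_le_card fun x hx => ?_)
  rw [Finset.mem_filter] at hx ⊢
  exact ⟨hx.1, hx.2.trans_le h⟩

theorem fst_add_snd (l : Fin (p + q + 1)) : (φ.fst l : ℕ) + (φ.snd l : ℕ) = l := by
  have hd : Disjoint (φ.1.filter fun x : Fin (p + q) => (x : ℕ) < l) (φ.1ᶜ.filter fun x : Fin (p + q) => (x : ℕ) < l) :=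
    Finset.disjoint_filter_filter (disjoint_compl_right (a := φ.1))
  change (φ.1.filter fun x : Fin (p + q) => (x : ℕ) < l).card + (φ.1ᶜ.filter fun x : Fin (p + q) => (x : ℕ) < l).card = l
  rw [← Finset.card_union_of_disjoint hd, ← Finset.filter_union, Finset.union_compl]
  rw [Fin.card_filter_val_lt]
  have := l.2
  omega

theorem strictMono {V W : Type} [PartialOrder V] [PartialOrder W] {v : Fin (p + 1) → V}
    {w : Fin (q + 1) → W} (hv : StrictMono v) (hw : StrictMono w) :
    StrictMono fun l => (v (φ.fst l), w (φ.snd l)) := by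
  intro l m h
  have h1 := φ.fst_mono h.le
  have h2 := φ.snd_mono h.le
  refine lt_of_le_of_ne ⟨hv.monotone h1, hw.monotone h2⟩ fun e => ?_
  have e1 := hv.injective (Prod.ext_iff.mp e).1
  have e2 := hw.injective (Prod.ext_iff.mp e).2
  have h3 := φ.fst_add_snd l
  have h4 := φ.fst_add_snd m
  rw [e1, e2] at h3
  exact absurd h (by rw [Fin.lt_def]; omega)

end Shuffle

section Cross

variable {V W : Type} [DecidableEq V] [DecidableEq W] [PartialOrder V] [PartialOrder W]
  {X : PreAbstractSimplicialComplex V} {Y : PreAbstractSimplicialComplex W} {p q : ℕ}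

/-- The simplex `[(v_{φ'(0)}, w_{φ''(0)}), …, (v_{φ'(p+q)}, w_{φ''(p+q)})]` of the product. -/
def shuffleSimplex (φ : Shuffle p q) (v : OSimplex X p) (w : OSimplex Y q) :
    OSimplex (ordProd X Y) (p + q) :=
  ⟨fun l => (v.1 (φ.fst l), w.1 (φ.snd l)), φ.strictMono v.2.1 w.2.1, by
    refine ⟨?_, ?_, ?_⟩
    · rw [Finset.coe_image, Finset.coe_univ, Set.image_univ]
      exact (φ.strictMono v.2.1 w.2.1).monotone.isChain_range
    · refine (X.isRelLowerSet_faces v.2.2).2 ?_ ((Finset.univ_nonempty.image _).image _)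
      intro x hx
      simp only [Finset.mem_image, Finset.mem_univ, true_and, exists_exists_eq_and] at hx ⊢
      obtain ⟨l, rfl⟩ := hx
      exact ⟨_, rfl⟩
    · refine (Y.isRelLowerSet_faces w.2.2).2 ?_ ((Finset.univ_nonempty.image _).image _)
      intro x hx
      simp only [Finset.mem_image, Finset.mem_univ, true_and, exists_exists_eq_and] at hx ⊢
      obtain ⟨l, rfl⟩ := hx
      exact ⟨_, rfl⟩⟩

/-- The simplicial cross product `s × t`, a sum over all shuffles with their signs. -/
noncomputable def cross (k : Type*) [Field k] (X : PreAbstractSimplicialComplex V)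
    (Y : PreAbstractSimplicialComplex W) (p q : ℕ) :
    Chain k X p →ₗ[k] Chain k Y q →ₗ[k] Chain k (ordProd X Y) (p + q) :=
  Finsupp.linearCombination k fun v : OSimplex X p =>
    Finsupp.linearCombination k fun w : OSimplex Y q =>
      ∑ φ : Shuffle p q, Finsupp.single (shuffleSimplex φ v w) (φ.sgn : k)

end Cross

/-! ### The triangulations of the associahedra -/

/-- The triangulation `T_n` of the associahedron `K_n`, `n ≥ 2`: the cone with apex `ξ_n` over the
union of the images `ι_t (T_a × T_b)`, `a + b = n + 1`, `a, b ≥ 2`, `2 ≤ t ≤ b`. There is no `K_n`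
for `n < 2`, which is encoded by the void complex. -/
def triang (n : ℕ) : PreAbstractSimplicialComplex Bracketing :=
  if n < 2 then ⊥ else
    cone (⨆ (a : ℕ) (b : ℕ) (t : ℕ) (_h : 2 ≤ a ∧ 2 ≤ b ∧ a + b = n + 1 ∧ 2 ≤ t ∧ t ≤ b),
      (ordProd (triang a) (triang b)).map (iota t)) (xi n)
termination_by n
decreasing_by all_goals omega

theorem isChain_image {α β : Type} [PartialOrder α] [PartialOrder β] {s : Set α}
    (hs : IsChain (· ≤ ·) s) (f : α → β) (hf : ∀ x y, x ≤ y → f x ≤ f y) :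
    IsChain (· ≤ ·) (f '' s) := by
  rintro _ ⟨x, hx, rfl⟩ _ ⟨y, hy, rfl⟩ _
  exact (hs.total hx hy).imp (hf x y) (hf y x)

theorem mem_cone {V : Type} [DecidableEq V] {X : PreAbstractSimplicialComplex V} {v : V}
    {σ : Finset V} : σ ∈ cone X v ↔ σ.Nonempty ∧ (σ.erase v = ∅ ∨ σ.erase v ∈ X) := Iff.rfl

theorem mem_ordProd {V W : Type} [DecidableEq V] [DecidableEq W] [PartialOrder V] [PartialOrder W]
    {X : PreAbstractSimplicialComplex V} {Y : PreAbstractSimplicialComplex W}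
    {σ : Finset (V × W)} : σ ∈ ordProd X Y ↔
      IsChain (· ≤ ·) (σ : Set (V × W)) ∧ σ.image Prod.fst ∈ X ∧ σ.image Prod.snd ∈ Y := Iff.rfl

theorem mem_of_subset {V : Type} {X : PreAbstractSimplicialComplex V} {σ τ : Finset V}
    (hσ : σ ∈ X) (h : τ ⊆ σ) (hτ : τ.Nonempty) : τ ∈ X :=
  (X.isRelLowerSet_faces hσ).2 h hτ

theorem nonempty_of_mem {V : Type} {X : PreAbstractSimplicialComplex V} {σ : Finset V}
    (hσ : σ ∈ X) : σ.Nonempty :=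
  (X.isRelLowerSet_faces hσ).1

/-- The base of the cone `T_n`. -/
def base (n : ℕ) : PreAbstractSimplicialComplex Bracketing :=
  ⨆ (a : ℕ) (b : ℕ) (t : ℕ) (_h : 2 ≤ a ∧ 2 ≤ b ∧ a + b = n + 1 ∧ 2 ≤ t ∧ t ≤ b),
    (ordProd (triang a) (triang b)).map (iota t)

theorem triang_of_two_le {n : ℕ} (hn : 2 ≤ n) : triang n = cone (base n) (xi n) := by
  rw [triang, if_neg (by omega), base]

theorem triang_of_lt {n : ℕ} (hn : n < 2) : triang n = ⊥ := by
  rw [triang, if_pos hn]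

theorem mem_iSup' {V : Type} {ι : Sort*} {X : ι → PreAbstractSimplicialComplex V} {σ : Finset V} :
    σ ∈ ⨆ i, X i ↔ ∃ i, σ ∈ X i := by
  change σ ∈ ⋃ K ∈ Set.range X, K.faces ↔ _
  simp only [Set.mem_range, Set.iUnion_exists, Set.iUnion_iUnion_eq', Set.mem_iUnion]
  rfl

theorem mem_base {n : ℕ} {σ : Finset Bracketing} : σ ∈ base n ↔
    ∃ a b t, (2 ≤ a ∧ 2 ≤ b ∧ a + b = n + 1 ∧ 2 ≤ t ∧ t ≤ b) ∧
      ∃ τ ∈ ordProd (triang a) (triang b), τ.image (iota t) = σ := by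
  simp only [base, mem_iSup', exists_prop]
  rfl

theorem two_le_of_mem {n : ℕ} {σ : Finset Bracketing} (h : σ ∈ triang n) : 2 ≤ n := by
  by_contra hn
  rw [triang_of_lt (by omega)] at h
  exact h

theorem length_of_mem {n : ℕ} {σ : Finset Bracketing} (h : σ ∈ triang n) {u : Bracketing}
    (hu : u ∈ σ) : u.length = n := by
  induction n using Nat.strong_induction_on generalizing σ u with
  | _ n ih =>
    have hn := two_le_of_mem h
    rw [triang_of_two_le hn, mem_cone] at h
    by_cases hx : u = xi n
    · rw [hx, length_xi (by omega)]
    have hu' : u ∈ σ.erase (xi n) := Finset.mem_erase.mpr ⟨hx, hu⟩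
    clear hx
    rcases h.2 with h | h
    · rw [h] at hu'
      exact absurd hu' (Finset.notMem_empty _)
    · obtain ⟨a, b, t, hab, τ, hτ, hτσ⟩ := mem_base.mp h
      rw [← hτσ] at hu'
      obtain ⟨x, hx, rfl⟩ := Finset.mem_image.mp hu'
      have h1 := ih a (by omega) hτ.2.1 (Finset.mem_image_of_mem _ hx)
      have h2 := ih b (by omega) hτ.2.2 (Finset.mem_image_of_mem _ hx)
      have h3 := length_graft t x.1 x.2
      change (graft t x.1 x.2).length = n
      omega

theorem mem_triang_of_erase {n : ℕ} (hn : 2 ≤ n) {σ τ : Finset Bracketing} (hσ : σ.Nonempty)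
    (h : σ.erase (xi n) ⊆ τ) (hτ : τ.Nonempty → τ ∈ base n) : σ ∈ triang n := by
  rw [triang_of_two_le hn, mem_cone]
  refine ⟨hσ, ?_⟩
  rcases Finset.eq_empty_or_nonempty (σ.erase (xi n)) with h' | h'
  · exact Or.inl h'
  · exact Or.inr (mem_of_subset (hτ (h'.mono h)) h h')

theorem graft_one_xi {a b : ℕ} (ha : 1 ≤ a) (hb : 1 ≤ b) :
    graft 1 (xi a) (xi b) = xi (a + b - 1) := by
  induction b, hb using Nat.le_induction with
  | base => rfl
  | succ b hb ih =>
    rw [xi_succ hb, graft_one_mul, ih, ← xi_succ (by omega)]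
    congr 1
    omega

/-- Each face of `T_n` is totally ordered by `≺`. -/
theorem isChain_of_mem {n : ℕ} {σ : Finset Bracketing} (h : σ ∈ triang n) :
    IsChain (· ≤ ·) (σ : Set Bracketing) := by
  have hn := two_le_of_mem h
  have hl := fun u hu => length_of_mem (u := u) h hu
  rw [triang_of_two_le hn, mem_cone] at h
  have key : IsChain (· ≤ ·) ((σ.erase (xi n) : Finset Bracketing) : Set Bracketing) := by
    rcases h.2 with h | h
    · rw [h, Finset.coe_empty]
      exact Set.subsingleton_empty.isChain
    · obtain ⟨a, b, t, -, τ, hτ, hτσ⟩ := mem_base.mp h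
      rw [← hτσ, Finset.coe_image]
      exact isChain_image hτ.1 (iota t) fun _ _ h => iota_mono t h
  intro u hu v hv huv
  by_cases h1 : u = xi n
  · exact Or.inl (h1 ▸ (isLeast_xi (by omega)).2 (hl v hv))
  by_cases h2 : v = xi n
  · exact Or.inr (h2 ▸ (isLeast_xi (by omega)).2 (hl u hu))
  exact key (Finset.mem_coe.mpr (Finset.mem_erase.mpr ⟨h1, hu⟩))
    (Finset.mem_coe.mpr (Finset.mem_erase.mpr ⟨h2, hv⟩)) huv

theorem le_of_iota_le {a b t : ℕ} {τ : Finset (Bracketing × Bracketing)}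
    (hτ : τ ∈ ordProd (triang a) (triang b)) {y z : Bracketing × Bracketing} (hy : y ∈ τ)
    (hz : z ∈ τ) (h : iota t y ≤ iota t z) : y ≤ z := by
  rcases hτ.1.total hy hz with h' | h'
  · exact h'
  have e : iota t y = iota t z := le_antisymm h (iota_mono t h')
  have l := fun {x} (hx : x ∈ τ) => length_of_mem hτ.2.1 (Finset.mem_image_of_mem Prod.fst hx)
  have r := fun {x} (hx : x ∈ τ) => length_of_mem hτ.2.2 (Finset.mem_image_of_mem Prod.snd hx)
  obtain ⟨e1, e2⟩ := graft_inj t ((l hy).trans (l hz).symm) ((r hy).trans (r hz).symm) e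
  exact (Prod.ext e1 e2).le

theorem image_iota_one_mem_aux (m : ℕ) : ∀ a b : ℕ, a + b = m →
    ∀ σ ∈ ordProd (triang a) (triang b), σ.image (iota 1) ∈ triang (a + b - 1) := by
  induction m using Nat.strong_induction_on with
  | _ m ih =>
  rintro a b hab σ hσ
  have ha := two_le_of_mem hσ.2.1
  have hb := two_le_of_mem hσ.2.2
  have hne : σ.Nonempty := Finset.image_nonempty.mp (nonempty_of_mem hσ.2.1)
  refine mem_triang_of_erase (τ := (σ.erase (xi a, xi b)).image (iota 1)) (by omega)
    (hne.image _) ?_ ?_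
  · intro u hu
    obtain ⟨h1, h2⟩ := Finset.mem_erase.mp hu
    obtain ⟨x, hx, rfl⟩ := Finset.mem_image.mp h2
    refine Finset.mem_image_of_mem _ (Finset.mem_erase.mpr ⟨?_, hx⟩)
    rintro rfl
    exact h1 (graft_one_xi (by omega) (by omega))
  intro hne'
  replace hne' := Finset.image_nonempty.mp hne'
  have hapex : (xi a, xi b) ∉ σ.erase (xi a, xi b) := Finset.notMem_erase _ _
  replace hσ : σ.erase (xi a, xi b) ∈ ordProd (triang a) (triang b) :=
    mem_of_subset hσ (Finset.erase_subset _ _) hne'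
  generalize σ.erase (xi a, xi b) = σ at hσ hapex hne'
  clear hne
  have hcase : (xi a ∉ σ.image Prod.fst) ∨ (xi b ∉ σ.image Prod.snd) := by
    by_contra! hcon
    obtain ⟨x, hx, ex⟩ := Finset.mem_image.mp hcon.1
    obtain ⟨y, hy, ey⟩ := Finset.mem_image.mp hcon.2
    rcases hσ.1.total hx hy with h | h
    · have : x = (xi a, xi b) := Prod.ext ex (eq_xi_of_le (by omega) (ey ▸ h.2))
      exact hapex (this ▸ hx)
    · have : y = (xi a, xi b) := Prod.ext (eq_xi_of_le (by omega) (ex ▸ h.1)) ey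
      exact hapex (this ▸ hy)
  rcases hcase with hx | hx
  · have h := hσ.2.1
    rw [triang_of_two_le ha, mem_cone, Finset.erase_eq_of_notMem hx] at h
    rcases h.2 with h' | h'
    · exact absurd h' h.1.ne_empty
    obtain ⟨c, d, s, ⟨hc, hd, hcd, hs, hsd⟩, τ, hτ, e⟩ := mem_base.mp h'
    have hl := fun {y} (hy : y ∈ τ) => length_of_mem hτ.2.2 (Finset.mem_image_of_mem Prod.snd hy)
    let ν : Finset ((Bracketing × Bracketing) × Bracketing) :=
      (τ ×ˢ σ.image Prod.snd).filter fun x => (iota s x.1, x.2) ∈ σ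
    have hν : ∀ {x}, x ∈ ν ↔ x.1 ∈ τ ∧ (iota s x.1, x.2) ∈ σ := by
      intro x
      simp only [ν, Finset.mem_filter, Finset.mem_product]
      exact ⟨fun h => ⟨h.1.1, h.2⟩, fun h => ⟨⟨h.1, Finset.mem_image_of_mem Prod.snd h.2⟩, h.2⟩⟩
    have hcov : ∀ x ∈ σ, ∃ y ∈ τ, iota s y = x.1 := fun x hx => by
      have := Finset.mem_image_of_mem Prod.fst hx
      rw [← e] at this
      exact Finset.mem_image.mp this
    have hνne : ν.Nonempty := by
      obtain ⟨x, hx⟩ := hne'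
      obtain ⟨y, hy, hyx⟩ := hcov x hx
      exact ⟨(y, x.2), hν.mpr ⟨hy, by rw [hyx]; exact hx⟩⟩
    have hchain : IsChain (· ≤ ·) (ν : Set ((Bracketing × Bracketing) × Bracketing)) := by
      intro x hx y hy _
      rw [Finset.mem_coe, hν] at hx hy
      rcases hσ.1.total hx.2 hy.2 with h | h
      · exact Or.inl ⟨le_of_iota_le hτ hx.1 hy.1 h.1, h.2⟩
      · exact Or.inr ⟨le_of_iota_le hτ hy.1 hx.1 h.1, h.2⟩
    let μ := ν.image fun x => (x.1.2, x.2)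
    have hμ : μ ∈ ordProd (triang d) (triang b) := by
      refine ⟨?_, mem_of_subset hτ.2.2 ?_ ((hνne.image _).image _),
        mem_of_subset hσ.2.2 ?_ ((hνne.image _).image _)⟩
      · simp only [μ, Finset.coe_image]
        exact isChain_image hchain _ fun _ _ h => ⟨h.1.2, h.2⟩
      · rw [Finset.image_image]
        exact Finset.image_subset_iff.mpr fun x hx =>
          Finset.mem_image.mpr ⟨_, (hν.mp hx).1, rfl⟩
      · rw [Finset.image_image]
        exact Finset.image_subset_iff.mpr fun x hx =>
          Finset.mem_image.mpr ⟨_, (hν.mp hx).2, rfl⟩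
    have hμ' := ih (d + b) (by omega) d b rfl μ hμ
    refine mem_base.mpr ⟨c, d + b - 1, s, ⟨hc, by omega, by omega, hs, by omega⟩,
      ν.image fun x => (x.1.1, graft 1 x.1.2 x.2), ⟨?_, ?_, ?_⟩, ?_⟩
    · rw [Finset.coe_image]
      exact isChain_image hchain _ fun x y h =>
        ⟨h.1.1, iota_mono 1 (show (x.1.2, x.2) ≤ (y.1.2, y.2) from ⟨h.1.2, h.2⟩)⟩
    · refine mem_of_subset hτ.2.1 ?_ ((hνne.image _).image _)
      rw [Finset.image_image]
      exact Finset.image_subset_iff.mpr fun x hx =>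
        Finset.mem_image.mpr ⟨_, (hν.mp hx).1, rfl⟩
    · rw [Finset.image_image] at hμ' ⊢
      exact hμ'
    · rw [Finset.image_image]
      ext u
      simp only [Finset.mem_image]
      constructor
      · rintro ⟨x, hx, rfl⟩
        refine ⟨_, (hν.mp hx).2, ?_⟩
        exact graft_one_graft s _ _ _ (hsd.trans (hl (hν.mp hx).1).ge)
      · rintro ⟨x, hx, rfl⟩
        obtain ⟨y, hy, hyx⟩ := hcov x hx
        refine ⟨(y, x.2), hν.mpr ⟨hy, by rw [hyx]; exact hx⟩, ?_⟩
        refine (graft_one_graft s _ _ _ (hsd.trans (hl hy).ge)).symm.trans ?_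
        change graft 1 (iota s y) x.2 = iota 1 x
        rw [hyx]
        rfl
  · have h := hσ.2.2
    rw [triang_of_two_le hb, mem_cone, Finset.erase_eq_of_notMem hx] at h
    rcases h.2 with h' | h'
    · exact absurd h' h.1.ne_empty
    obtain ⟨c, d, s, ⟨hc, hd, hcd, hs, hsd⟩, τ, hτ, e⟩ := mem_base.mp h'
    have hl := fun {y} (hy : y ∈ τ) => length_of_mem hτ.2.2 (Finset.mem_image_of_mem Prod.snd hy)
    have hla := fun {y} (hy : y ∈ σ) => length_of_mem hσ.2.1 (Finset.mem_image_of_mem Prod.fst hy)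
    let ν : Finset (Bracketing × (Bracketing × Bracketing)) :=
      (σ.image Prod.fst ×ˢ τ).filter fun x => (x.1, iota s x.2) ∈ σ
    have hν : ∀ {x}, x ∈ ν ↔ x.2 ∈ τ ∧ (x.1, iota s x.2) ∈ σ := by
      intro x
      simp only [ν, Finset.mem_filter, Finset.mem_product]
      exact ⟨fun h => ⟨h.1.2, h.2⟩, fun h => ⟨⟨Finset.mem_image_of_mem Prod.fst h.2, h.1⟩, h.2⟩⟩
    have hcov : ∀ x ∈ σ, ∃ y ∈ τ, iota s y = x.2 := fun x hx => by
      have := Finset.mem_image_of_mem Prod.snd hx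
      rw [← e] at this
      exact Finset.mem_image.mp this
    have hνne : ν.Nonempty := by
      obtain ⟨x, hx⟩ := hne'
      obtain ⟨y, hy, hyx⟩ := hcov x hx
      exact ⟨(x.1, y), hν.mpr ⟨hy, by rw [hyx]; exact hx⟩⟩
    have hchain : IsChain (· ≤ ·) (ν : Set (Bracketing × (Bracketing × Bracketing))) := by
      intro x hx y hy _
      rw [Finset.mem_coe, hν] at hx hy
      rcases hσ.1.total hx.2 hy.2 with h | h
      · exact Or.inl ⟨h.1, le_of_iota_le hτ hx.1 hy.1 h.2⟩
      · exact Or.inr ⟨h.1, le_of_iota_le hτ hy.1 hx.1 h.2⟩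
    let μ := ν.image fun x => (x.1, x.2.2)
    have hμ : μ ∈ ordProd (triang a) (triang d) := by
      refine ⟨?_, mem_of_subset hσ.2.1 ?_ ((hνne.image _).image _),
        mem_of_subset hτ.2.2 ?_ ((hνne.image _).image _)⟩
      · simp only [μ, Finset.coe_image]
        exact isChain_image hchain _ fun _ _ h => ⟨h.1, h.2.2⟩
      · rw [Finset.image_image]
        exact Finset.image_subset_iff.mpr fun x hx =>
          Finset.mem_image.mpr ⟨_, (hν.mp hx).2, rfl⟩
      · rw [Finset.image_image]
        exact Finset.image_subset_iff.mpr fun x hx =>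
          Finset.mem_image.mpr ⟨_, (hν.mp hx).1, rfl⟩
    have hμ' := ih (a + d) (by omega) a d rfl μ hμ
    have heq : ∀ x ∈ ν, graft (s + a - 1) x.2.1 (graft 1 x.1 x.2.2) =
        graft 1 x.1 (iota s x.2) := fun x hx => by
      have h1 := hla (hν.mp hx).2
      have h2 := graft_one_disjoint s x.1 x.2.1 x.2.2 hs (hsd.trans (hl (hν.mp hx).1).ge)
      rw [h1] at h2
      exact h2.symm
    refine mem_base.mpr ⟨c, a + d - 1, s + a - 1,
      ⟨hc, by omega, by omega, by omega, by omega⟩,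
      ν.image fun x => (x.2.1, graft 1 x.1 x.2.2), ⟨?_, ?_, ?_⟩, ?_⟩
    · rw [Finset.coe_image]
      exact isChain_image hchain _ fun x y h =>
        ⟨h.2.1, iota_mono 1 (show (x.1, x.2.2) ≤ (y.1, y.2.2) from ⟨h.1, h.2.2⟩)⟩
    · refine mem_of_subset hτ.2.1 ?_ ((hνne.image _).image _)
      rw [Finset.image_image]
      exact Finset.image_subset_iff.mpr fun x hx =>
        Finset.mem_image.mpr ⟨_, (hν.mp hx).1, rfl⟩
    · rw [Finset.image_image] at hμ' ⊢
      exact hμ'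
    · rw [Finset.image_image]
      ext u
      simp only [Finset.mem_image]
      constructor
      · rintro ⟨x, hx, rfl⟩
        exact ⟨_, (hν.mp hx).2, (heq x hx).symm⟩
      · rintro ⟨x, hx, rfl⟩
        obtain ⟨y, hy, hyx⟩ := hcov x hx
        have hm : (x.1, y) ∈ ν := hν.mpr ⟨hy, by rw [hyx]; exact hx⟩
        refine ⟨(x.1, y), hm, (heq _ hm).trans ?_⟩
        change graft 1 x.1 (iota s y) = iota 1 x
        rw [hyx]
        rfl

/-- `ι_t` is a simplicial map `T_a × T_b → T_{a+b-1}`, so it maps chains to chains. -/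
theorem image_iota_mem (t a b : ℕ) :
    ∀ σ ∈ ordProd (triang a) (triang b), σ.image (iota t) ∈ triang (a + b - 1) := by
  intro σ hσ
  have ha := two_le_of_mem hσ.2.1
  have hb := two_le_of_mem hσ.2.2
  have hne : σ.Nonempty := Finset.image_nonempty.mp (nonempty_of_mem hσ.2.1)
  have hl := fun {y} (hy : y ∈ σ) => length_of_mem hσ.2.2 (Finset.mem_image_of_mem Prod.snd hy)
  have main : ∀ t, 2 ≤ t → t ≤ b → σ.image (iota t) ∈ triang (a + b - 1) := fun t h1 h2 =>
    mem_triang_of_erase (by omega) (hne.image _) (Finset.erase_subset _ _) fun _ =>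
      mem_base.mpr ⟨a, b, t, ⟨ha, hb, by omega, h1, h2⟩, σ, hσ, rfl⟩
  have one := image_iota_one_mem_aux _ a b rfl σ hσ
  rcases Nat.lt_or_ge t 2 with h | h
  · have : t = 0 ∨ t = 1 := by omega
    rcases this with rfl | rfl
    · rw [show iota 0 = iota 1 from funext fun x => graft_zero x.1 x.2]
      exact one
    · exact one
  · rcases Nat.le_total t b with h' | h'
    · exact main t h h'
    · rw [Finset.image_congr (g := iota b)]
      · exact main b hb le_rfl
      · intro x hx
        have := graft_big x.1 (v := x.2) (t := t) (by rw [hl hx]; exact h')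
        rw [hl hx] at this
        exact this

/-! ### The chains of the associahedra and the comp operations -/

section Lie

variable (k : Type*) [Field k]

/-- `C_p(K_n)`, the oriented simplicial `p`-chains of `T_n`. -/
abbrev AssocChain (p n : ℕ) : Type _ := Chain k (triang n) p

/-- The comp operation `s ⋄_t u = (ι_t)_* (s × u)`. -/
noncomputable def diamond (t p a q b : ℕ) :
    AssocChain k p a →ₗ[k] AssocChain k q b →ₗ[k] AssocChain k (p + q) (a + b - 1) :=
  (cross k (triang a) (triang b) p q).compr₂
    (pushforward k (iota t) (iota_mono t) (image_iota_mem t a b) (p + q))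

/-- `s ⋄ u = ∑_{1 ≤ t ≤ b} (-1)^{(a+1)(t+q+1)} s ⋄_t u` for `s ∈ C_p(K_a)` and `u ∈ C_q(K_b)`. -/
noncomputable def preLie (p a q b : ℕ) :
    AssocChain k p a →ₗ[k] AssocChain k q b →ₗ[k] AssocChain k (p + q) (a + b - 1) :=
  ∑ t ∈ Finset.Icc 1 b, (-1 : k) ^ ((a + 1) * (t + q + 1)) • diamond k t p a q b

/-- `C(K)`, the direct sum of all `C_p(K_n)`; the summand with index `(p, n)` is `C_p(K_n)`
(it is `0` for `n < 2`, where `K_n` does not exist). -/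
abbrev TotalChain : Type _ := ⨁ x : ℕ × ℕ, AssocChain k x.1 x.2

noncomputable instance : AddCommGroup (TotalChain k) := DirectSum.instAddCommGroup

/-- The inclusion of the summand `C_p(K_n)`. -/
noncomputable def incl (p n : ℕ) : AssocChain k p n →ₗ[k] TotalChain k :=
  DirectSum.lof k (ℕ × ℕ) (fun x => AssocChain k x.1 x.2) (p, n)

/-- The degree `n - p - 1` of the elements of `C_p(K_n)`. -/
def deg (p n : ℕ) : ℤ := (n : ℤ) - p - 1

/-- `C(K)^m`, the sum of all `C_p(K_n)` with `n - p - 1 = m`. -/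
noncomputable def grading (m : ℤ) : Submodule k (TotalChain k) :=
  ⨆ (p : ℕ) (n : ℕ) (_ : deg p n = m), LinearMap.range (incl k p n)

/-- The bilinear operation on `C(K)` with given values on pairs of summands. -/
noncomputable def bilinearOfSummands
    (F : ∀ p a q b : ℕ, AssocChain k p a →ₗ[k] AssocChain k q b →ₗ[k] TotalChain k) :
    TotalChain k →ₗ[k] TotalChain k →ₗ[k] TotalChain k :=
  DirectSum.toModule k (ℕ × ℕ) (TotalChain k →ₗ[k] TotalChain k) fun x =>
    (DirectSum.toModule k (ℕ × ℕ) (AssocChain k x.1 x.2 →ₗ[k] TotalChain k) fun y =>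
      (F x.1 x.2 y.1 y.2).flip).flip

/-- The bracket `[s, u] = s ⋄ u - (-1)^{|s| |u|} u ⋄ s`, bilinearly extended to `C(K)`. -/
noncomputable def bracket : TotalChain k →ₗ[k] TotalChain k →ₗ[k] TotalChain k :=
  bilinearOfSummands k fun p a q b =>
    (preLie k p a q b).compr₂ (incl k (p + q) (a + b - 1)) -
      (deg p a * deg q b).negOnePow •
        ((preLie k q b p a).compr₂ (incl k (q + p) (b + a - 1))).flip

/-- The simplicial differential `d_S` of `C(K)`. -/
noncomputable def dS : TotalChain k →ₗ[k] TotalChain k :=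
  DirectSum.toModule k (ℕ × ℕ) (TotalChain k) fun
    | (0, _) => 0
    | (p + 1, n) => incl k p n ∘ₗ boundary k (triang n) p

end Lie

/-- `(L, [-,-], d)` with the subspaces `L^i = 𝒜 i` is a differential graded Lie algebra over a field
of characteristic zero (with a differential of degree `1`). -/
structure IsDGLieAlgebra (k : Type*) [Field k] {L : Type*} [AddCommGroup L] [Module k L]
    (𝒜 : ℤ → Submodule k L) (br : L →ₗ[k] L →ₗ[k] L) (d : L →ₗ[k] L) : Prop where
  isInternal : DirectSum.IsInternal 𝒜
  bracket_mem : ∀ {i j : ℤ} {x y : L}, x ∈ 𝒜 i → y ∈ 𝒜 j → br x y ∈ 𝒜 (i + j)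
  d_mem : ∀ {i : ℤ} {x : L}, x ∈ 𝒜 i → d x ∈ 𝒜 (i + 1)
  skew : ∀ {i j : ℤ} {x y : L}, x ∈ 𝒜 i → y ∈ 𝒜 j → br x y = -((i * j).negOnePow • br y x)
  jacobi : ∀ {i j l : ℤ} {x y z : L}, x ∈ 𝒜 i → y ∈ 𝒜 j → z ∈ 𝒜 l →
    br x (br y z) = br (br x y) z + (i * j).negOnePow • br y (br x z)
  d_d : ∀ x : L, d (d x) = 0
  leibniz : ∀ {i j : ℤ} {x y : L}, x ∈ 𝒜 i → y ∈ 𝒜 j →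
    d (br x y) = br (d x) y + i.negOnePow • br x (d y)

end Associahedron

/-! The bracket is the graded commutator of `⋄`, and the graded commutator of a graded left pre-Lie
product satisfies the Jacobi identity. So it suffices that the associator x ⋄ (y ⋄ z) - (x ⋄ y) ⋄ z
is graded symmetric in x and y. Expanded over slots, x ⋄ (y ⋄ z) inserts x either into the inserted
y or at another slot of z. The first kind adds up to (x ⋄ y) ⋄ z, by `graft_graft_nested` and the
associativity `listCross_assoc` of the cross product. The second kind inserts x and y at two
different slots of z. It is symmetric by `graft_graft_disjoint` and the graded commutativity of the
cross product, and the signs in `⋄` are such that the total sign is (-1)^(|x||y|). The result is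
`listPreLie_associator`.

For the Leibniz rule, each ι_t commutes with boundaries, and ∂(s × t) = ∂s × t + (-1)^p s × ∂t. The
sign in `⋄` depends on the dimension q of the second factor; passing to ∂t costs (-1)^(a+1), which
turns (-1)^p into (-1)^(a-p-1) = (-1)^|s|.

The facts on cross products are proved for linear combinations of lists of vertices. There the
product is a recursion on the first move of a lattice path and the boundary a recursion on the first
vertex, so everything is an induction on lengths, with no complexes or dimensions in the types.
`toListChain_boundary`, `toListChain_cross` and `toListChain_pushforward_iota` compare the
operations, and `totalToList_injective` carries identities back to C(K). The list boundary is
augmented (a vertex goes to the empty list), whereas d_S is not; `dropNil` removes the difference,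
and products with the empty list vanish. -/

namespace Associahedron

/-! ### Chains of lists -/

section Lists

variable (k : Type*) [Field k] {U V W V' W' : Type}

/-- Putting a vertex in front of every simplex. -/
noncomputable def consMap (v : V) : (List V →₀ k) →ₗ[k] (List V →₀ k) :=
  Finsupp.lmapDomain k k (List.cons v)

/-- The map on chains of lists that is induced by a map of vertices. -/
noncomputable def listMap (f : V → W) : (List V →₀ k) →ₗ[k] (List W →₀ k) :=
  Finsupp.lmapDomain k k (List.map f)

/-- The coefficient of the empty list. -/
noncomputable def nilCoeff : (List V →₀ k) →ₗ[k] k := Finsupp.lapply []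

/-- Multiplication of each list by the sign of its length. -/
noncomputable def lengthSign : (List V →₀ k) →ₗ[k] (List V →₀ k) :=
  Finsupp.linearCombination k fun l => (-1 : k) ^ l.length • Finsupp.single l 1

/-- The augmented boundary of chains of lists. -/
noncomputable def listBoundaryAux : List V → (List V →₀ k)
  | [] => 0
  | v :: vs => Finsupp.single vs 1 - consMap k v (listBoundaryAux vs)

/-- The augmented boundary of chains of lists. -/
noncomputable def listBoundary : (List V →₀ k) →ₗ[k] (List V →₀ k) :=
  Finsupp.linearCombination k (listBoundaryAux k)

/-- The sum of all lattice paths with the signs of the shuffles that they define. -/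
noncomputable def listCrossAux : List V → List W → (List (V × W) →₀ k)
  | [], _ => 0
  | _ :: _, [] => 0
  -- A path starts at `(v, w)` and moves next in one of the factors. A first move in the second
  -- factor precedes all `vs.length` moves in the first factor, hence the sign. The empty list ends
  -- the path when both factors are single vertices; the two recursive terms vanish then.
  | v :: vs, w :: ws => consMap k (v, w) (listCrossAux vs (w :: ws) +
      (-1 : k) ^ vs.length • listCrossAux (v :: vs) ws +
        if vs = [] ∧ ws = [] then Finsupp.single [] 1 else 0)
termination_by vs ws => vs.length + ws.length

/-- The cross product of chains of lists. -/
noncomputable def listCross :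
    (List V →₀ k) →ₗ[k] (List W →₀ k) →ₗ[k] (List (V × W) →₀ k) :=
  Finsupp.linearCombination k fun vs =>
    Finsupp.linearCombination k fun ws => listCrossAux k vs ws

variable {k}

@[simp] theorem consMap_single (v : V) (l : List V) (c : k) :
    consMap k v (Finsupp.single l c) = Finsupp.single (v :: l) c := by
  simp [consMap]

@[simp] theorem listMap_single (f : V → W) (l : List V) (c : k) :
    listMap k f (Finsupp.single l c) = Finsupp.single (l.map f) c := by
  simp [listMap]

theorem listMap_listMap (f : V → W) (g : W → U) (A : List V →₀ k) :
    listMap k g (listMap k f A) = listMap k (g ∘ f) A := by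
  induction A using Finsupp.induction_linear with
  | zero => simp
  | add A B hA hB => simp [hA, hB]
  | single l c => simp

@[simp] theorem listMap_consMap (f : V → W) (v : V) (A : List V →₀ k) :
    listMap k f (consMap k v A) = consMap k (f v) (listMap k f A) := by
  induction A using Finsupp.induction_linear with
  | zero => simp
  | add A B hA hB => simp [hA, hB]
  | single l c => simp

@[simp] theorem nilCoeff_consMap (v : V) (A : List V →₀ k) : nilCoeff k (consMap k v A) = 0 := by
  induction A using Finsupp.induction_linear with
  | zero => simp
  | add A B hA hB => simp [hA, hB]
  | single l c => simp [nilCoeff]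

@[simp] theorem nilCoeff_single (l : List V) (c : k) :
    nilCoeff k (Finsupp.single l c) = if l = [] then c else 0 := by
  simp [nilCoeff, Finsupp.single_apply]

@[simp] theorem lengthSign_single (l : List V) (c : k) :
    lengthSign k (Finsupp.single l c) = (-1 : k) ^ l.length • Finsupp.single l c := by
  simp [lengthSign, mul_comm]

@[simp] theorem lengthSign_consMap (v : V) (A : List V →₀ k) :
    lengthSign k (consMap k v A) = -consMap k v (lengthSign k A) := by
  induction A using Finsupp.induction_linear with
  | zero => simp
  | add A B hA hB => simp [hA, hB, add_comm]
  | single l c =>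
    simp only [consMap_single, lengthSign_single, List.length_cons, map_smul, pow_succ, mul_neg,
      mul_one, neg_smul]

@[simp] theorem listBoundary_single (l : List V) :
    listBoundary k (Finsupp.single l (1 : k)) = listBoundaryAux k l := by
  simp [listBoundary]

theorem listBoundary_consMap (v : V) (A : List V →₀ k) :
    listBoundary k (consMap k v A) = A - consMap k v (listBoundary k A) := by
  induction A using Finsupp.induction_linear with
  | zero => simp
  | add A B hA hB => simp only [map_add, hA, hB]; abel
  | single l c => simp [listBoundary, listBoundaryAux, smul_sub]

theorem listBoundary_listBoundary (A : List V →₀ k) : listBoundary k (listBoundary k A) = 0 := by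
  induction A using Finsupp.induction_linear with
  | zero => simp
  | add A B hA hB => simp [hA, hB]
  | single l c =>
    rw [← mul_one c, ← smul_eq_mul, ← Finsupp.smul_single, map_smul, map_smul]
    suffices h : listBoundary k (listBoundary k (Finsupp.single l (1 : k))) = 0 by rw [h, smul_zero]
    induction l with
    | nil => simp [listBoundaryAux]
    | cons v l ih =>
      rw [← consMap_single, listBoundary_consMap, map_sub, listBoundary_consMap, ih]
      simp

@[simp] theorem listCross_single (vs : List V) (ws : List W) :
    listCross k (Finsupp.single vs (1 : k)) (Finsupp.single ws 1) = listCrossAux k vs ws := by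
  simp [listCross]

@[simp] theorem listCrossAux_nil_left (ws : List W) : listCrossAux k ([] : List V) ws = 0 := by
  rw [listCrossAux]

@[simp] theorem listCrossAux_nil_right (vs : List V) : listCrossAux k vs ([] : List W) = 0 := by
  cases vs <;> rw [listCrossAux]

theorem listCrossAux_cons (v : V) (vs : List V) (w : W) (ws : List W) :
    listCrossAux k (v :: vs) (w :: ws) = consMap k (v, w) (listCrossAux k vs (w :: ws) +
      (-1 : k) ^ vs.length • listCrossAux k (v :: vs) ws +
        if vs = [] ∧ ws = [] then Finsupp.single [] 1 else 0) := by
  rw [listCrossAux]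

/-- Bilinear maps on chains of lists that agree on lists are equal. -/
theorem list_bilin_ext {N : Type*} [AddCommGroup N] [Module k N]
    {F G : (List V →₀ k) →ₗ[k] (List W →₀ k) →ₗ[k] N}
    (h : ∀ vs ws, F (Finsupp.single vs 1) (Finsupp.single ws 1) =
      G (Finsupp.single vs 1) (Finsupp.single ws 1)) : F = G := by
  ext vs ws
  simpa using h vs ws

/-- The recursion of `listCrossAux` for chains instead of lists, as iterated products and boundaries
require: `lengthSign` carries the sign, and `nilCoeff` detects a pair of single vertices. -/
theorem listCross_consMap (v : V) (w : W) (A : List V →₀ k) (B : List W →₀ k) :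
    listCross k (consMap k v A) (consMap k w B) = consMap k (v, w)
      (listCross k A (consMap k w B) + listCross k (consMap k v (lengthSign k A)) B +
        (nilCoeff k A * nilCoeff k B) • Finsupp.single [] 1) := by
  induction A using Finsupp.induction_linear with
  | zero => simp
  | add A A' hA hA' =>
    simp only [map_add, LinearMap.add_apply, hA, hA', add_mul, add_smul]
    abel
  | single vs c =>
    induction B using Finsupp.induction_linear with
    | zero => simp
    | add B B' hB hB' =>
      simp only [map_add, hB, hB', mul_add, add_smul]
      abel
    | single ws d =>
      rw [← mul_one c, ← smul_eq_mul, ← Finsupp.smul_single, ← mul_one d, ← smul_eq_mul (a := d),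
        ← Finsupp.smul_single]
      simp only [map_smul, LinearMap.smul_apply, consMap_single, listCross_single,
        lengthSign_single, nilCoeff_single, listCrossAux_cons, ← smul_add, smul_eq_mul]
      rw [← map_smul, ← map_smul]
      congr 1
      by_cases h1 : vs = [] <;> by_cases h2 : ws = [] <;>
        simp [h1, h2, smul_smul, mul_comm]

theorem nilCoeff_listCrossAux (vs : List V) (ws : List W) :
    nilCoeff k (listCrossAux k vs ws) = 0 := by
  cases vs with
  | nil => simp
  | cons v vs =>
    cases ws with
    | nil => simp
    | cons w ws => rw [listCrossAux_cons, nilCoeff_consMap]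

theorem listCross_nil_left (B : List W →₀ k) (c : k) :
    listCross k (Finsupp.single ([] : List V) c) B = 0 := by
  induction B using Finsupp.induction_linear with
  | zero => simp
  | add B B' hB hB' => simp [hB, hB']
  | single ws d => simp [listCross]

theorem listCross_nil_right (A : List V →₀ k) (c : k) :
    listCross k A (Finsupp.single ([] : List W) c) = 0 := by
  induction A using Finsupp.induction_linear with
  | zero => simp
  | add B B' hB hB' => simp [hB, hB']
  | single ws d => simp [listCross]

/-- Each path has `vs.length + ws.length - 1` vertices; the exponent has the same parity and avoids
subtraction. -/
theorem lengthSign_listCrossAux (vs : List V) (ws : List W) :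
    lengthSign k (listCrossAux k vs ws) =
      (-1 : k) ^ (vs.length + ws.length + 1) • listCrossAux k vs ws := by
  induction h : vs.length + ws.length using Nat.strong_induction_on generalizing vs ws with
  | _ n ih =>
    subst h
    cases vs with
    | nil => simp
    | cons v vs =>
      cases ws with
      | nil => simp
      | cons w ws =>
        have h1 := ih _ (by simp) vs (w :: ws) rfl
        have h2 := ih _ (by simp) (v :: vs) ws rfl
        rw [listCrossAux_cons, lengthSign_consMap, map_add (lengthSign k), map_add (lengthSign k), h1, map_smul, h2, ← map_neg,
          ← map_smul]
        congr 1
        simp only [List.length_cons]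
        split_ifs with h
        · simp [h.1, h.2, pow_succ]
        · simp only [map_zero, add_zero, smul_add, smul_smul, neg_add, ← neg_smul]
          ring_nf

theorem listMap_prodMap_listCrossAux (f : V → V') (g : W → W') (vs : List V) (ws : List W) :
    listMap k (Prod.map f g) (listCrossAux k vs ws) =
      listCrossAux k (vs.map f) (ws.map g) := by
  induction h : vs.length + ws.length using Nat.strong_induction_on generalizing vs ws with
  | _ n ih =>
    subst h
    cases vs with
    | nil => simp
    | cons v vs =>
      cases ws with
      | nil => simp
      | cons w ws =>
        have h1 := ih _ (by simp) vs (w :: ws) rfl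
        have h2 := ih _ (by simp) (v :: vs) ws rfl
        simp only [List.map_cons] at h1 h2
        rw [listCrossAux_cons, listMap_consMap, map_add (listMap k _), map_add (listMap k _), h1, map_smul, h2, List.map_cons,
          List.map_cons, listCrossAux_cons]
        simp only [List.map_eq_nil_iff, List.length_map, Prod.map_apply]
        congr 2
        split_ifs <;> simp

theorem listCross_listMap (f : V → V') (g : W → W') (A : List V →₀ k) (B : List W →₀ k) :
    listCross k (listMap k f A) (listMap k g B) = listMap k (Prod.map f g) (listCross k A B) := by
  have : (listCross k).compl₁₂ (listMap k f) (listMap k g) =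
      (listCross k).compr₂ (listMap k (Prod.map f g)) :=
    list_bilin_ext fun vs ws => by simp [listMap_prodMap_listCrossAux]
  exact LinearMap.congr_fun₂ this A B

/-- Graded commutativity. The sign is (-1)^(pq) for the dimensions p, q, which are the lengths minus
one; `+ 1` has the same parity. -/
theorem listMap_swap_listCrossAux (vs : List V) (ws : List W) :
    listMap k Prod.swap (listCrossAux k vs ws) =
      (-1 : k) ^ ((vs.length + 1) * (ws.length + 1)) • listCrossAux k ws vs := by
  induction h : vs.length + ws.length using Nat.strong_induction_on generalizing vs ws with
  | _ n ih =>
    subst h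
    cases vs with
    | nil => simp
    | cons v vs =>
      cases ws with
      | nil => simp
      | cons w ws =>
        have h1 := ih _ (by simp) vs (w :: ws) rfl
        have h2 := ih _ (by simp) (v :: vs) ws rfl
        rw [listCrossAux_cons, listMap_consMap, map_add (listMap k _), map_add (listMap k _), h1, map_smul, h2,
          listCrossAux_cons, ← map_smul, Prod.swap_prod_mk]
        congr 1
        simp only [List.length_cons]
        by_cases h : vs = [] ∧ ws = []
        · simp [h.1, h.2, pow_succ]
        · have h' : ¬ (ws = [] ∧ vs = []) := fun e => h e.symm
          have e1 : (-1 : k) ^ ((vs.length + 1) * (ws.length + 1 + 1)) =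
              (-1 : k) ^ ((vs.length + 1 + 1) * (ws.length + 1 + 1)) * (-1) ^ ws.length := by
            rw [← pow_add]
            refine neg_one_pow_congr ?_
            simp only [Nat.even_add, Nat.even_mul, Nat.even_add_one]
            tauto
          have e2 : (-1 : k) ^ vs.length * (-1 : k) ^ ((vs.length + 1 + 1) * (ws.length + 1)) =
              (-1 : k) ^ ((vs.length + 1 + 1) * (ws.length + 1 + 1)) := by
            rw [← pow_add]
            refine neg_one_pow_congr ?_
            simp only [Nat.even_add, Nat.even_mul, Nat.even_add_one]
            tauto
          rw [if_neg h, if_neg h', smul_smul, e1, e2, smul_add, smul_add, smul_smul]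
          simp [add_comm]

/-- Both sides obey the same recursion: a path in the triple product starts at the three first
vertices and moves next in one of the three factors, which gives the three induction hypotheses. -/
theorem listCross_assoc_single (us : List U) (vs : List V) (ws : List W) :
    listMap k (Equiv.prodAssoc U V W) (listCross k (listCrossAux k us vs) (Finsupp.single ws 1)) =
      listCross k (Finsupp.single us 1) (listCrossAux k vs ws) := by
  induction h : us.length + vs.length + ws.length using Nat.strong_induction_on
    generalizing us vs ws with
  | _ n ih =>
    subst h
    cases us with
    | nil => simp [listCross_nil_left]
    | cons u us =>
      cases vs with
      | nil => simp
      | cons v vs =>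
        cases ws with
        | nil => simp [listCross_nil_right]
        | cons w ws =>
          have h1 := ih _ (by simp) us (v :: vs) (w :: ws) rfl
          have h2 := ih _ (by simp) (u :: us) vs (w :: ws) rfl
          have h3 := ih _ (by simp) (u :: us) (v :: vs) ws rfl
          -- What follows the first vertex consists of lists of length `us.length + vs.length`, so
          -- `lengthSign` acts on it as a scalar.
          have e1 : lengthSign k (listCrossAux k us (v :: vs) +
              (-1 : k) ^ us.length • listCrossAux k (u :: us) vs +
                if us = [] ∧ vs = [] then Finsupp.single [] 1 else 0) =
              (-1 : k) ^ (us.length + vs.length) • (listCrossAux k us (v :: vs) +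
              (-1 : k) ^ us.length • listCrossAux k (u :: us) vs +
                if us = [] ∧ vs = [] then Finsupp.single [] 1 else 0) := by
            rw [map_add, map_add, map_smul, lengthSign_listCrossAux, lengthSign_listCrossAux]
            split_ifs with h
            · simp [h.1, h.2]
            · simp only [List.length_cons, map_zero, smul_zero, smul_add, smul_smul]
              ring_nf
          rw [listCrossAux_cons u us v vs, ← consMap_single w ws, listCross_consMap, e1, map_smul,
            ← listCrossAux_cons, listMap_consMap, listCrossAux_cons v vs w ws,
            ← consMap_single u us, listCross_consMap, ← listCrossAux_cons]
          simp only [map_add, LinearMap.add_apply, map_smul, LinearMap.smul_apply, consMap_single,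
            h1, h2, h3, lengthSign_single, nilCoeff_listCrossAux, nilCoeff_single,
            Equiv.prodAssoc_apply, smul_zero, zero_add, pow_add, mul_smul]
          by_cases hu : us = [] <;> by_cases hv : vs = [] <;> by_cases hw : ws = [] <;>
            simp [hu, hv, hw, listCross_nil_left, listCross_nil_right] <;> module

theorem listCross_assoc (A : List U →₀ k) (B : List V →₀ k) (C : List W →₀ k) :
    listMap k (Equiv.prodAssoc U V W) (listCross k (listCross k A B) C) =
      listCross k A (listCross k B C) := by
  induction A using Finsupp.induction_linear with
  | zero => simp
  | add A A' hA hA' => simp [hA, hA']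
  | single us c =>
    induction B using Finsupp.induction_linear with
    | zero => simp
    | add B B' hB hB' => simp [hB, hB']
    | single vs d =>
      induction C using Finsupp.induction_linear with
      | zero => simp
      | add C C' hC hC' => simp [hC, hC']
      | single ws e =>
        rw [← mul_one c, ← smul_eq_mul, ← Finsupp.smul_single, ← mul_one d, ← smul_eq_mul (a := d),
          ← Finsupp.smul_single, ← mul_one e, ← smul_eq_mul (a := e), ← Finsupp.smul_single]
        simp only [map_smul, LinearMap.smul_apply, listCross_single, listCross_assoc_single]

/-! ### The boundary of a cross product -/

theorem nilCoeff_listBoundaryAux (vs : List V) :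
    nilCoeff k (listBoundaryAux k vs) = if vs.length = 1 then 1 else 0 := by
  cases vs with
  | nil => simp [listBoundaryAux]
  | cons v vs => simp [listBoundaryAux]

theorem lengthSign_listBoundaryAux (vs : List V) :
    lengthSign k (listBoundaryAux k vs) = -(-1 : k) ^ vs.length • listBoundaryAux k vs := by
  induction vs with
  | nil => simp [listBoundaryAux]
  | cons v vs ih =>
    rw [listBoundaryAux, map_sub, lengthSign_single, lengthSign_consMap, ih, List.length_cons,
      pow_succ, map_smul]
    module

/-- The last term comes from the augmentation: for two single vertices the boundary of the product
is the empty list, while both products on the right have an empty factor and vanish. -/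
theorem listBoundary_listCrossAux (v : V) (vs : List V) (w : W) (ws : List W) :
    listBoundary k (listCrossAux k (v :: vs) (w :: ws)) =
      listCross k (listBoundaryAux k (v :: vs)) (Finsupp.single (w :: ws) 1) +
      (-1 : k) ^ vs.length •
        listCross k (Finsupp.single (v :: vs) 1) (listBoundaryAux k (w :: ws)) +
      if vs = [] ∧ ws = [] then Finsupp.single [] 1 else 0 := by
  induction h : vs.length + ws.length using Nat.strong_induction_on generalizing v vs w ws with
  | _ n ih =>
    subst h
    -- The first factor is one vertex shorter, so its Leibniz sign is the opposite one. The empty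
    -- `vs`, which the induction hypothesis does not cover, is checked directly; likewise for `ws`
    -- in `h2`.
    have h1 : listBoundary k (listCrossAux k vs (w :: ws)) =
        listCross k (listBoundaryAux k vs) (Finsupp.single (w :: ws) 1) -
        (-1 : k) ^ vs.length •
          listCross k (Finsupp.single vs 1) (listBoundaryAux k (w :: ws)) +
        if vs.length = 1 ∧ ws = [] then Finsupp.single [] 1 else 0 := by
      cases vs with
      | nil => simp [listBoundaryAux, listCross_nil_left]
      | cons v' vs =>
        rw [ih _ (by simp) v' vs w ws rfl, List.length_cons, pow_succ]
        simp
    have h2 : listBoundary k (listCrossAux k (v :: vs) ws) =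
        listCross k (listBoundaryAux k (v :: vs)) (Finsupp.single ws 1) +
        (-1 : k) ^ vs.length •
          listCross k (Finsupp.single (v :: vs) 1) (listBoundaryAux k ws) +
        if vs = [] ∧ ws.length = 1 then Finsupp.single [] 1 else 0 := by
      cases ws with
      | nil => simp [listBoundaryAux, listCross_nil_right]
      | cons w' ws =>
        rw [ih _ (by simp) v vs w' ws rfl]
        simp
    have h3 : listBoundary k (if vs = [] ∧ ws = [] then Finsupp.single [] 1 else 0 :
        List (V × W) →₀ k) = 0 := by
      split_ifs <;> simp [listBoundaryAux]
    have h4 : consMap k (v, w) (if vs = [] ∧ ws = [] then Finsupp.single [] 1 else 0) =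
        (if vs = [] ∧ ws = [] then Finsupp.single [(v, w)] 1 else 0 : List (V × W) →₀ k) := by
      split_ifs <;> simp
    have h5 := listCross_consMap v w (listBoundaryAux k vs) (Finsupp.single ws 1)
    have h6 := listCross_consMap v w (Finsupp.single vs 1) (listBoundaryAux k ws)
    simp only [lengthSign_listBoundaryAux, nilCoeff_listBoundaryAux, consMap_single, map_smul,
      lengthSign_single, nilCoeff_single, LinearMap.smul_apply] at h5 h6
    rw [listCrossAux_cons, listBoundary_consMap, map_add (listBoundary k),
      map_add (listBoundary k), h1, map_smul, h2, h3]
    simp only [listBoundaryAux, map_sub, LinearMap.sub_apply, listCross_single, h5, h6]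
    simp only [map_add, map_sub, map_smul, map_zero, smul_add, smul_sub]
    generalize (-1 : k) ^ vs.length = c
    simp only [ite_and]
    split_ifs <;> simp only [mul_one, mul_zero, one_smul, zero_smul, map_zero] <;> module

end Lists

/-! ### Oriented simplicial chains as chains of lists -/

theorem listBoundaryAux_ofFn {k : Type*} [Field k] {V : Type} {p : ℕ} (v : Fin (p + 1) → V) :
    listBoundaryAux k (List.ofFn v) =
      ∑ i : Fin (p + 1), (-1 : k) ^ (i : ℕ) • Finsupp.single (List.ofFn (v ∘ i.succAbove)) 1 := by
  induction p with
  | zero => simp [listBoundaryAux]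
  | succ p ih =>
    rw [List.ofFn_succ, listBoundaryAux, ih, Fin.sum_univ_succ (n := p + 1), sub_eq_add_neg,
      map_sum, ← Finset.sum_neg_distrib]
    congr 1
    · simp [Function.comp_def]
    · refine Finset.sum_congr rfl fun i _ => ?_
      rw [map_smul, consMap_single, Fin.val_succ, pow_succ, mul_neg, mul_one, neg_smul]
      congr 4
      rw [List.ofFn_succ]
      simp [Function.comp_def]

section Compare

variable (k : Type*) [Field k] {V W : Type} [DecidableEq V] [DecidableEq W] [PartialOrder V]
  [PartialOrder W] {X : PreAbstractSimplicialComplex V} {Y : PreAbstractSimplicialComplex W}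

/-- The list of the vertices of an oriented simplex. -/
def OSimplex.toList {p : ℕ} (v : OSimplex X p) : List V := List.ofFn v.1

/-- Oriented chains as chains of lists. -/
noncomputable def toListChain (X : PreAbstractSimplicialComplex V) (p : ℕ) :
    Chain k X p →ₗ[k] (List V →₀ k) :=
  Finsupp.lmapDomain k k OSimplex.toList

variable {k}

@[simp] theorem toListChain_single {p : ℕ} (v : OSimplex X p) (c : k) :
    toListChain k X p (Finsupp.single v c) = Finsupp.single v.toList c := by
  simp [toListChain]

theorem toListChain_boundary (p : ℕ) (x : Chain k X (p + 1)) :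
    toListChain k X p (boundary k X p x) = listBoundary k (toListChain k X (p + 1) x) := by
  induction x using Finsupp.induction_linear with
  | zero => simp
  | add x y hx hy => simp [hx, hy]
  | single v c =>
    have h : boundary k X p (Finsupp.single v 1) =
        ∑ i : Fin (p + 2), (-1 : k) ^ (i : ℕ) • Finsupp.single (v.face i) (1 : k) := by
      simp [boundary]
    rw [← mul_one c, ← smul_eq_mul, ← Finsupp.smul_single]
    simp only [map_smul, h, map_sum, toListChain_single, listBoundary_single]
    rw [OSimplex.toList, listBoundaryAux_ofFn]
    rfl

theorem listBoundary_toListChain_zero (x : Chain k X 0) :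
    ∃ c : k, listBoundary k (toListChain k X 0 x) = Finsupp.single [] c := by
  induction x using Finsupp.induction_linear with
  | zero => exact ⟨0, by simp⟩
  | add x y hx hy =>
    obtain ⟨c, hc⟩ := hx
    obtain ⟨d, hd⟩ := hy
    exact ⟨c + d, by simp [hc, hd]⟩
  | single v c =>
    refine ⟨c, ?_⟩
    rw [← mul_one c, ← smul_eq_mul, ← Finsupp.smul_single]
    rw [map_smul, map_smul, toListChain_single, listBoundary_single, OSimplex.toList]
    simp [listBoundaryAux]

end Compare

/-! ### Lattice paths -/

section Paths

variable {n : ℕ} {V W : Type}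

/-- The number of inversions of a subset. -/
def inversions (I : Finset (Fin n)) : ℕ :=
  ((Finset.univ : Finset (Fin n × Fin n)).filter
    (fun x => x.1 ∈ I ∧ x.2 ∉ I ∧ x.2 < x.1)).card

/-- The number of elements of a subset that are less than `l`. -/
def countBelow (I : Finset (Fin n)) (l : ℕ) : ℕ := (I.filter fun x : Fin n => (x : ℕ) < l).card

/-- The lattice path of a subset. -/
def pathList (I : Finset (Fin n)) (v : ℕ → V) (w : ℕ → W) : List (V × W) :=
  List.ofFn fun l : Fin (n + 1) => (v (countBelow I l), w (l - countBelow I l))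

theorem countBelow_le (I : Finset (Fin n)) (l : ℕ) : countBelow I l ≤ l := by
  refine (Finset.card_le_card (Finset.filter_subset_filter _ (Finset.subset_univ I))).trans ?_
  rw [Fin.card_filter_val_lt]
  exact min_le_right _ _

theorem countBelow_zero (I : Finset (Fin n)) : countBelow I 0 = 0 := by
  simp [countBelow]

theorem countBelow_map_succ (I : Finset (Fin n)) (l : ℕ) :
    countBelow (I.map (Fin.succEmb n)) (l + 1) = countBelow I l := by
  simp [countBelow, Finset.filter_map, Function.comp_def]

theorem countBelow_insert_zero (I : Finset (Fin n)) (l : ℕ) :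
    countBelow (insert 0 (I.map (Fin.succEmb n))) (l + 1) = countBelow I l + 1 := by
  have := countBelow_map_succ I l
  unfold countBelow at *
  rw [Finset.filter_insert, if_pos (by simp), Finset.card_insert_of_notMem (by simp), this]

theorem pathList_map_succ (I : Finset (Fin n)) (v : ℕ → V) (w : ℕ → W) :
    pathList (I.map (Fin.succEmb n)) v w = (v 0, w 0) :: pathList I v (w ∘ Nat.succ) := by
  unfold pathList
  rw [List.ofFn_succ]
  simp only [Fin.val_zero, countBelow_zero, Nat.sub_zero, Fin.val_succ, countBelow_map_succ]
  congr 2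
  ext1 l
  have := countBelow_le I l
  rw [Function.comp_apply, Nat.succ_eq_add_one, Nat.sub_add_comm this]

theorem pathList_insert_zero (I : Finset (Fin n)) (v : ℕ → V) (w : ℕ → W) :
    pathList (insert 0 (I.map (Fin.succEmb n))) v w =
      (v 0, w 0) :: pathList I (v ∘ Nat.succ) w := by
  unfold pathList
  rw [List.ofFn_succ]
  simp only [Fin.val_zero, countBelow_zero, Nat.sub_zero, Fin.val_succ, countBelow_insert_zero,
    Nat.add_sub_add_right, Function.comp_apply, Nat.succ_eq_add_one]

theorem inversions_eq_sum (I : Finset (Fin n)) :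
    inversions I = ∑ x : Fin n, ∑ y : Fin n, if x ∈ I ∧ y ∉ I ∧ y < x then 1 else 0 := by
  rw [inversions, Finset.card_filter, Fintype.sum_prod_type]

/-- The new element 0 is outside of the subset and below it, so it forms an inversion with each
element. -/
theorem inversions_map_succ (I : Finset (Fin n)) :
    inversions (I.map (Fin.succEmb n)) = inversions I + I.card := by
  simp only [inversions_eq_sum, Fin.sum_univ_succ]
  simp [Finset.sum_add_distrib, add_comm]

theorem inversions_insert_zero (I : Finset (Fin n)) :
    inversions (insert 0 (I.map (Fin.succEmb n))) = inversions I := by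
  simp only [inversions_eq_sum, Fin.sum_univ_succ]
  simp [Fin.succ_ne_zero]

variable (k : Type*) [Field k]

/-- The signed sum of the lattice paths of the subsets with `p` elements. -/
noncomputable def pathSum (n p : ℕ) (v : ℕ → V) (w : ℕ → W) : List (V × W) →₀ k :=
  ∑ I ∈ Finset.powersetCard p (Finset.univ : Finset (Fin n)),
    (-1 : k) ^ inversions I • Finsupp.single (pathList I v w) 1

variable {k}

theorem sum_powersetCard_map_succ {N : Type*} [AddCommMonoid N] (p : ℕ)
    (F : Finset (Fin (n + 1)) → N) :
    ∑ I ∈ Finset.powersetCard p ((Finset.univ : Finset (Fin n)).map (Fin.succEmb n)), F I =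
      ∑ I ∈ Finset.powersetCard p (Finset.univ : Finset (Fin n)), F (I.map (Fin.succEmb n)) := by
  rw [Finset.powersetCard_map, Finset.sum_map]
  rfl

/-- Splits the subsets by whether they contain 0, that is, the paths by their first move. -/
theorem sum_powersetCard_succ {N : Type*} [AddCommMonoid N] (p : ℕ)
    (F : Finset (Fin (n + 1)) → N) :
    ∑ I ∈ Finset.powersetCard (p + 1) (Finset.univ : Finset (Fin (n + 1))), F I =
      ∑ I ∈ Finset.powersetCard (p + 1) (Finset.univ : Finset (Fin n)),
        F (I.map (Fin.succEmb n)) +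
      ∑ I ∈ Finset.powersetCard p (Finset.univ : Finset (Fin n)),
        F (insert 0 (I.map (Fin.succEmb n))) := by
  have h0 : (0 : Fin (n + 1)) ∉ (Finset.univ : Finset (Fin n)).map (Fin.succEmb n) := by simp
  have hu : (Finset.univ : Finset (Fin (n + 1))) =
      insert 0 ((Finset.univ : Finset (Fin n)).map (Fin.succEmb n)) := by
    rw [Fin.univ_succ, Finset.cons_eq_insert]
    rfl
  have hm : ∀ {m : ℕ} {I : Finset (Fin (n + 1))},
      I ∈ Finset.powersetCard m ((Finset.univ : Finset (Fin n)).map (Fin.succEmb n)) → 0 ∉ I :=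
    fun h h' => h0 ((Finset.mem_powersetCard.mp h).1 h')
  rw [hu, Finset.powersetCard_succ_insert h0, Finset.sum_union, Finset.sum_image,
    sum_powersetCard_map_succ, sum_powersetCard_map_succ]
  · intro I hI J hJ h
    rw [← Finset.erase_insert (hm hI), ← Finset.erase_insert (hm hJ)]
    exact congrArg (fun s => s.erase 0) h
  · rw [Finset.disjoint_left]
    intro I hI hI'
    obtain ⟨J, -, rfl⟩ := Finset.mem_image.mp hI'
    exact hm hI (Finset.mem_insert_self _ _)

theorem pathSum_succ_zero (v : ℕ → V) (w : ℕ → W) :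
    pathSum k (n + 1) 0 v w = consMap k (v 0, w 0) (pathSum k n 0 v (w ∘ Nat.succ)) := by
  have h : (∅ : Finset (Fin (n + 1))) = (∅ : Finset (Fin n)).map (Fin.succEmb n) := by simp
  simp only [pathSum, Finset.powersetCard_zero, Finset.sum_singleton]
  rw [h, pathList_map_succ, inversions_map_succ]
  simp

theorem pathSum_succ_succ (p : ℕ) (v : ℕ → V) (w : ℕ → W) :
    pathSum k (n + 1) (p + 1) v w = consMap k (v 0, w 0) (pathSum k n p (v ∘ Nat.succ) w +
      (-1 : k) ^ (p + 1) • pathSum k n (p + 1) v (w ∘ Nat.succ)) := by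
  rw [pathSum, sum_powersetCard_succ, add_comm, map_add, map_smul]
  simp only [pathSum, map_sum, Finset.smul_sum, map_smul, consMap_single, pathList_insert_zero,
    inversions_insert_zero]
  congr 1
  refine Finset.sum_congr rfl fun I hI => ?_
  rw [pathList_map_succ, inversions_map_succ, (Finset.mem_powersetCard.mp hI).2, smul_smul, add_comm,
    pow_add]

theorem pathSum_of_lt {p : ℕ} (h : n < p) (v : ℕ → V) (w : ℕ → W) : pathSum k n p v w = 0 := by
  rw [pathSum, Finset.powersetCard_eq_empty.mpr (by simpa using h), Finset.sum_empty]

/-- Both sides obey the same recursion on the first move. The vertices are functions on `ℕ`, so that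
dropping the first one is composition with `Nat.succ`. -/
theorem pathSum_eq (p q : ℕ) (v : ℕ → V) (w : ℕ → W) :
    pathSum k (p + q) p v w =
      listCrossAux k ((List.range (p + 1)).map v) ((List.range (q + 1)).map w) := by
  have hr : ∀ {U : Type} (m : ℕ) (f : ℕ → U),
      (List.range (m + 1)).map f = f 0 :: (List.range m).map (f ∘ Nat.succ) := fun m f => by
    rw [List.range_succ_eq_map, List.map_cons, List.map_map]
  induction h : p + q generalizing p q v w with
  | zero =>
    obtain ⟨rfl, rfl⟩ : p = 0 ∧ q = 0 := by omega
    rw [hr, hr, listCrossAux_cons]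
    simp [pathSum, pathList, inversions, countBelow]
  | succ n ih =>
    cases p with
    | zero =>
      obtain rfl : q = n + 1 := by omega
      rw [pathSum_succ_zero, ih 0 n _ _ (by omega), hr (n + 1), hr 0 v, listCrossAux_cons]
      simp
    | succ p =>
      rw [pathSum_succ_succ, ih p q _ _ (by omega), hr q w, hr (p + 1) v, listCrossAux_cons]
      simp only [← hr, List.length_map, List.length_range]
      cases q with
      -- Without vertices left in the second factor, there is no first move in it: no subset of `n =
      -- p` elements has `p + 1` of them.
      | zero => rw [pathSum_of_lt (by omega)]; simp
      | succ q => rw [ih (p + 1) q _ _ (by omega)]; simp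

end Paths

/-! ### Comparison of cross products, of the maps ι_t and of `⋄` -/

section Compare

variable {k : Type*} [Field k] {V W : Type} [DecidableEq V] [DecidableEq W] [PartialOrder V]
  [PartialOrder W] {X : PreAbstractSimplicialComplex V} {Y : PreAbstractSimplicialComplex W}

theorem OSimplex.toList_eq_map {p : ℕ} (v : OSimplex X p) :
    v.toList = (List.range (p + 1)).map fun i => v.1 (Fin.ofNat (p + 1) i) := by
  rw [OSimplex.toList, List.ofFn_eq_map, ← List.map_coe_finRange_eq_range, List.map_map]
  simp [Function.comp_def]

theorem toList_shuffleSimplex {p q : ℕ} (φ : Shuffle p q) (v : OSimplex X p) (w : OSimplex Y q) :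
    (shuffleSimplex φ v w).toList = pathList φ.1 (fun i => v.1 (Fin.ofNat (p + 1) i))
      (fun i => w.1 (Fin.ofNat (q + 1) i)) := by
  rw [OSimplex.toList, pathList]
  congr 1
  ext1 l
  have h1 : (φ.fst l : ℕ) = countBelow φ.1 l := rfl
  have h2 : (φ.snd l : ℕ) = l - countBelow φ.1 l := by
    have := φ.fst_add_snd l
    omega
  rw [← h2, ← h1, Fin.ofNat_val_eq_self, Fin.ofNat_val_eq_self]
  rfl

theorem toListChain_cross (p q : ℕ) (x : Chain k X p) (y : Chain k Y q) :
    toListChain k (ordProd X Y) (p + q) (cross k X Y p q x y) =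
      listCross k (toListChain k X p x) (toListChain k Y q y) := by
  have : (cross k X Y p q).compr₂ (toListChain k (ordProd X Y) (p + q)) =
      (listCross k).compl₁₂ (toListChain k X p) (toListChain k Y q) := by
    ext1 v
    ext1
    ext1 w
    ext1
    have h : (toListChain k (ordProd X Y) (p + q))
        (∑ φ : Shuffle p q, Finsupp.single (shuffleSimplex φ v w) (φ.sgn : k)) =
        listCrossAux k v.toList w.toList := by
      rw [OSimplex.toList_eq_map, OSimplex.toList_eq_map, ← pathSum_eq, map_sum, pathSum,
        Finset.sum_subtype (p := fun I : Finset (Fin (p + q)) => I.card = p) _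
          (by simp [Finset.mem_powersetCard])]
      refine Finset.sum_congr rfl fun φ _ => ?_
      rw [toListChain_single, toList_shuffleSimplex]
      simp [Shuffle.sgn, inversions]
    simpa [cross] using h
  exact LinearMap.congr_fun₂ this x y

/-- No simplex degenerates: the vertices of a face have fixed lengths, so ι_t is strictly monotone
on it by `le_of_iota_le`. The pushforward is therefore the plain map on lists. -/
theorem toListChain_pushforward_iota (t a b n : ℕ) (x : Chain k (ordProd (triang a) (triang b)) n) :
    toListChain k (triang (a + b - 1)) n
        (pushforward k (iota t) (iota_mono t) (image_iota_mem t a b) n x) =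
      listMap k (iota t) (toListChain k _ n x) := by
  induction x using Finsupp.induction_linear with
  | zero => simp
  | add x y hx hy => simp [hx, hy]
  | single v c =>
    have h : StrictMono (iota t ∘ v.1) := by
      intro i j hij
      refine lt_of_le_of_ne (iota_mono t (v.2.1 hij).le) fun e => ?_
      exact absurd (le_of_iota_le v.2.2 (Finset.mem_image_of_mem _ (Finset.mem_univ j))
        (Finset.mem_image_of_mem _ (Finset.mem_univ i)) e.ge) (v.2.1 hij).not_ge
    obtain ⟨w, hw, e⟩ : ∃ w : OSimplex (triang (a + b - 1)) n, w.1 = iota t ∘ v.1 ∧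
        pushforward k (iota t) (iota_mono t) (image_iota_mem t a b) n (Finsupp.single v 1) =
          Finsupp.single w (1 : k) := by
      refine ⟨⟨iota t ∘ v.1, h, ?_⟩, rfl, ?_⟩
      · rw [← Finset.image_image]
        exact image_iota_mem t a b _ v.2.2
      · simp only [pushforward, Finsupp.linearCombination_single, h, dite_true, one_smul]
    rw [← mul_one c, ← smul_eq_mul, ← Finsupp.smul_single]
    simp only [map_smul, e, toListChain_single, listMap_single, OSimplex.toList, List.map_ofFn, hw]

variable (k) in
/-- The operation `s ⋄ u` on chains of lists, with the parameters of its signs. -/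
noncomputable def listPreLie (a q b : ℕ) : (List Bracketing →₀ k) →ₗ[k]
    (List Bracketing →₀ k) →ₗ[k] (List Bracketing →₀ k) :=
  ∑ t ∈ Finset.Icc 1 b, (-1 : k) ^ ((a + 1) * (t + q + 1)) •
    (listCross k).compr₂ (listMap k (iota t))

theorem toListChain_preLie (p a q b : ℕ) (x : AssocChain k p a) (y : AssocChain k q b) :
    toListChain k _ _ (preLie k p a q b x y) =
      listPreLie k a q b (toListChain k _ _ x) (toListChain k _ _ y) := by
  simp [preLie, listPreLie, diamond, LinearMap.sum_apply, toListChain_pushforward_iota,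
    toListChain_cross]

end Compare

/-! ### Insertion identities -/

/-- Insertion of an outcome of insertion. -/
theorem graft_graft_nested (s j : ℕ) (u v w : Bracketing) (hs : 1 ≤ s) (hsv : s ≤ v.length)
    (hj : 1 ≤ j) (hjw : j ≤ w.length) :
    graft j (graft s u v) w = graft (j + s - 1) u (graft j v w) := by
  induction w using FreeMagma.recOnMul generalizing j with
  | ih1 _ =>
    obtain rfl : j = 1 := le_antisymm hjw hj
    rw [graft_of, graft_of, Nat.add_sub_cancel_left]
  | ih2 l r hl hr =>
    rw [length_mul'] at hjw
    rw [graft_mul, graft_mul]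
    split_ifs with h
    · have := length_graft j v l
      rw [graft_mul, if_pos (by omega), hl j hj h]
    · rw [graft_mul, if_neg (by omega), hr (j - l.length) (by omega) (by omega)]
      congr 2
      omega

/-- Two insertions at different places commute. -/
theorem graft_graft_disjoint (i j : ℕ) (u v w : Bracketing) (hi : 1 ≤ i) (hij : i < j)
    (hjw : j ≤ w.length) :
    graft i u (graft j v w) = graft (j + u.length - 1) v (graft i u w) := by
  have hu := u.length_pos
  have hv := v.length_pos
  induction w using FreeMagma.recOnMul generalizing i j with
  | ih1 _ =>
    change j ≤ 1 at hjw
    omega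
  | ih2 l r hl hr =>
    rw [length_mul'] at hjw
    have h1 := length_graft i u l
    have h2 := length_graft j v l
    by_cases h : j ≤ l.length
    · rw [graft_mul j, if_pos h, graft_mul i, if_pos (by omega), graft_mul i, if_pos (by omega),
        graft_mul, if_pos (by omega), hl i j hi hij h]
    · rw [graft_mul j, if_neg h]
      by_cases h' : i ≤ l.length
      · rw [graft_mul i, if_pos h', graft_mul i, if_pos h', graft_mul, if_neg (by omega)]
        congr 2
        omega
      · rw [graft_mul i, if_neg h', graft_mul i, if_neg h', graft_mul, if_neg (by omega),
          hr (i - l.length) (j - l.length) (by omega) (by omega) (by omega)]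
        congr 2
        omega

/-- Makes comparisons of signs polynomial identities over `ZMod 2`, which `decide` checks on all
values. -/
theorem neg_one_pow_eq_of_cast_eq {R : Type*} [Ring R] {m n : ℕ} (h : (m : ZMod 2) = n) :
    (-1 : R) ^ m = (-1) ^ n := by
  refine neg_one_pow_congr ?_
  rw [← ZMod.natCast_eq_zero_iff_even, ← ZMod.natCast_eq_zero_iff_even, h]

/-! ### Graded symmetry of the associator of `⋄` -/

section PreLie

variable {k : Type*} [Field k]

theorem listCross_left_comm {U V W : Type} (us : List U) (vs : List V) (C : List W →₀ k) :
    listCross k (Finsupp.single us 1) (listCross k (Finsupp.single vs 1) C) =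
      (-1 : k) ^ ((us.length + 1) * (vs.length + 1)) •
        listMap k (fun x : V × U × W => (x.2.1, x.1, x.2.2))
          (listCross k (Finsupp.single vs 1) (listCross k (Finsupp.single us 1) C)) := by
  have e : listCrossAux k us vs = (-1 : k) ^ ((us.length + 1) * (vs.length + 1)) •
      listMap k Prod.swap (listCrossAux k vs us) := by
    rw [listMap_swap_listCrossAux, smul_smul, mul_comm (vs.length + 1), ← mul_pow]
    simp
  -- Inserted so that the exchange of the first two factors is a map on both factors of a product,
  -- as `listCross_listMap` needs.
  have hC : listMap k (id : W → W) C = C := by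
    rw [listMap, List.map_id_fun]
    exact Finsupp.mapDomain_id
  rw [← listCross_assoc, ← listCross_assoc, listCross_single, listCross_single, e, map_smul,
    LinearMap.smul_apply, map_smul, listMap_listMap]
  congr 1
  conv_lhs => rw [← hC]
  rw [listCross_listMap, listMap_listMap]
  rfl

/-- Bracketings of `n` symbols. -/
abbrev BracketingOf (n : ℕ) : Type := {u : Bracketing // u.length = n}

/-- The sum over the slots `1, …, b + c - 1`, split by their position relative to those that come
from an insertion of `b` slots at the slot `j` of `1, …, c`. -/
theorem sum_Icc_slots {N : Type*} [AddCommMonoid N] {b c j : ℕ} (hb : 1 ≤ b) (hj : 1 ≤ j)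
    (hjc : j ≤ c) (F : ℕ → N) :
    ∑ i ∈ Finset.Icc 1 (b + c - 1), F i = ∑ s ∈ Finset.Icc 1 b, F (j + s - 1) +
      (∑ i ∈ Finset.Ico 1 j, F i + ∑ i ∈ Finset.Ioc j c, F (i + b - 1)) := by
  have h1 : ∑ s ∈ Finset.Icc 1 b, F (j + s - 1) = ∑ i ∈ Finset.Ico j (j + b), F i := by
    refine Finset.sum_nbij' (fun s => j + s - 1) (fun i => i + 1 - j) ?_ ?_ ?_ ?_ ?_ <;>
      simp only [Finset.mem_Icc, Finset.mem_Ico] <;> intros <;> first | trivial | omega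
  have h2 : ∑ i ∈ Finset.Ioc j c, F (i + b - 1) = ∑ i ∈ Finset.Ico (j + b) (b + c), F i := by
    refine Finset.sum_nbij' (fun s => s + b - 1) (fun i => i + 1 - b) ?_ ?_ ?_ ?_ ?_ <;>
      simp only [Finset.mem_Ioc, Finset.mem_Ico] <;> intros <;> first | trivial | omega
  have h3 : Finset.Icc 1 (b + c - 1) = Finset.Ico 1 (b + c) := by
    ext i
    simp only [Finset.mem_Icc, Finset.mem_Ico]
    omega
  rw [h1, h2, h3, add_left_comm, Finset.sum_Ico_consecutive _ (by omega) (by omega),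
    Finset.sum_Ico_consecutive _ hj (by omega)]

variable {a b c : ℕ}

/-- Insertion of the first bracketing at the slot `i` of the outcome of insertion of the second one
at the slot `j` of the third one. -/
def graft₂ (i j : ℕ) (x : BracketingOf a × BracketingOf b × BracketingOf c) : Bracketing :=
  graft i x.1.1 (graft j x.2.1.1 x.2.2.1)

/-- By naturality of the cross product all insertions move out of it, so only insertion maps on one
triple product are left to compare. -/
theorem listPreLie_listPreLie (A : List (BracketingOf a) →₀ k) (B : List (BracketingOf b) →₀ k)
    (C : List (BracketingOf c) →₀ k) (m r n : ℕ) :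
    listPreLie k a m n (listMap k Subtype.val A)
        (listPreLie k b r c (listMap k Subtype.val B) (listMap k Subtype.val C)) =
      ∑ j ∈ Finset.Icc 1 c, ∑ i ∈ Finset.Icc 1 n,
        ((-1 : k) ^ ((a + 1) * (i + m + 1)) * (-1) ^ ((b + 1) * (j + r + 1))) •
          listMap k (graft₂ i j) (listCross k A (listCross k B C)) := by
  simp only [listPreLie, LinearMap.sum_apply, LinearMap.smul_apply, LinearMap.compr₂_apply,
    map_sum, map_smul, Finset.smul_sum, listCross_listMap, listMap_listMap, smul_smul]
  refine Finset.sum_congr rfl fun j _ => Finset.sum_congr rfl fun i _ => ?_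
  rw [mul_comm]
  rfl

/-- Associativity of the cross product and `graft_graft_nested` bring this to the same triple
product. The latter needs slots in range, which the fixed lengths in `BracketingOf` guarantee for
all vertices. -/
theorem listPreLie_listPreLie_left (A : List (BracketingOf a) →₀ k)
    (B : List (BracketingOf b) →₀ k) (C : List (BracketingOf c) →₀ k) (m q r : ℕ) :
    listPreLie k m r c (listPreLie k a q b (listMap k Subtype.val A) (listMap k Subtype.val B))
        (listMap k Subtype.val C) =
      ∑ j ∈ Finset.Icc 1 c, ∑ s ∈ Finset.Icc 1 b,
        ((-1 : k) ^ ((m + 1) * (j + r + 1)) * (-1) ^ ((a + 1) * (s + q + 1))) •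
          listMap k (graft₂ (j + s - 1) j) (listCross k A (listCross k B C)) := by
  simp only [listPreLie, LinearMap.sum_apply, LinearMap.smul_apply, LinearMap.compr₂_apply,
    map_sum, map_smul, Finset.smul_sum, listCross_listMap, listMap_listMap, smul_smul]
  refine Finset.sum_comm.trans
    (Finset.sum_congr rfl fun j hj => Finset.sum_congr rfl fun s hs => ?_)
  rw [Finset.mem_Icc] at hj hs
  rw [← listCross_assoc, listMap_listMap, mul_comm]
  congr 1
  refine congrArg (fun f => listMap k f _) (funext fun x => ?_)
  exact graft_graft_nested s j x.1.1.1 x.1.2.1 x.2.1 hs.1 (by rw [x.1.2.2]; exact hs.2) hj.1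
    (by rw [x.2.2]; exact hj.2)

/-- The slots for the first chain are of three kinds: those of the inserted second bracketing, which
give the nested product, and the slots of the third one before `j` and after `j`, the latter shifted
by `b - 1`. -/
theorem listPreLie_eq_add (ha : 1 ≤ a) (hb : 1 ≤ b) (A : List (BracketingOf a) →₀ k)
    (B : List (BracketingOf b) →₀ k) (C : List (BracketingOf c) →₀ k) (q r : ℕ) :
    listPreLie k a (q + r) (b + c - 1) (listMap k Subtype.val A)
        (listPreLie k b r c (listMap k Subtype.val B) (listMap k Subtype.val C)) =
      listPreLie k (a + b - 1) r c
        (listPreLie k a q b (listMap k Subtype.val A) (listMap k Subtype.val B))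
        (listMap k Subtype.val C) +
      (∑ j ∈ Finset.Icc 1 c, ∑ i ∈ Finset.Ico 1 j,
        ((-1 : k) ^ ((a + 1) * (i + (q + r) + 1)) * (-1) ^ ((b + 1) * (j + r + 1))) •
          listMap k (graft₂ i j) (listCross k A (listCross k B C)) +
      ∑ j ∈ Finset.Icc 1 c, ∑ i ∈ Finset.Ioc j c,
        ((-1 : k) ^ ((a + 1) * (i + b - 1 + (q + r) + 1)) * (-1) ^ ((b + 1) * (j + r + 1))) •
          listMap k (graft₂ (i + b - 1) j) (listCross k A (listCross k B C))) := by
  rw [listPreLie_listPreLie, listPreLie_listPreLie_left, ← Finset.sum_add_distrib,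
    ← Finset.sum_add_distrib]
  refine Finset.sum_congr rfl fun j hj => ?_
  rw [Finset.mem_Icc] at hj
  rw [sum_Icc_slots hb hj.1 hj.2]
  congr 1
  refine Finset.sum_congr rfl fun s hs => ?_
  congr 1
  rw [Finset.mem_Icc] at hs
  -- Truncated subtractions have to go before the exponents are cast to `ZMod 2`.
  obtain ⟨a, rfl⟩ := Nat.exists_eq_add_of_le' ha
  obtain ⟨s, rfl⟩ := Nat.exists_eq_add_of_le' hs.1
  rw [← pow_add, ← pow_add]
  refine neg_one_pow_eq_of_cast_eq ?_
  rw [show j + (s + 1) - 1 = j + s by omega, show a + 1 + b - 1 = a + b by omega]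
  push_cast
  generalize (a : ZMod 2) = a
  generalize (b : ZMod 2) = b
  generalize (j : ZMod 2) = j
  generalize (q : ZMod 2) = q
  generalize (r : ZMod 2) = r
  generalize (s : ZMod 2) = s
  decide +revert

/-- Both sides insert at two different slots of the third bracketing, in opposite orders; the later
slot shifts by `a - 1` once the first bracketing is in place. The slot signs and the sign (-1)^(pq)
of the exchange combine to (-1)^(|x||y|). -/
theorem sum_disjoint_swap (ha : 1 ≤ a) {p q : ℕ} (r : ℕ) {us : List (BracketingOf a)}
    {vs : List (BracketingOf b)} (hu : us.length = p + 1) (hv : vs.length = q + 1)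
    (C : List (BracketingOf c) →₀ k) :
    ∑ j ∈ Finset.Icc 1 c, ∑ i ∈ Finset.Ico 1 j,
      ((-1 : k) ^ ((a + 1) * (i + (q + r) + 1)) * (-1) ^ ((b + 1) * (j + r + 1))) •
        listMap k (graft₂ i j)
          (listCross k (Finsupp.single us 1) (listCross k (Finsupp.single vs 1) C)) =
    (-1 : k) ^ ((a + p + 1) * (b + q + 1)) •
      ∑ j ∈ Finset.Icc 1 c, ∑ i ∈ Finset.Ioc j c,
        ((-1 : k) ^ ((b + 1) * (i + a - 1 + (p + r) + 1)) * (-1) ^ ((a + 1) * (j + r + 1))) •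
          listMap k (graft₂ (i + a - 1) j)
            (listCross k (Finsupp.single vs 1) (listCross k (Finsupp.single us 1) C)) := by
  -- On the right the outer slot is that of the first chain, so it becomes the outer one here too.
  rw [Finset.sum_comm' (t' := Finset.Icc 1 c) (s' := fun i => Finset.Ioc i c), Finset.smul_sum]
  · refine Finset.sum_congr rfl fun i hi => ?_
    rw [Finset.smul_sum]
    refine Finset.sum_congr rfl fun j hj => ?_
    rw [Finset.mem_Icc] at hi
    rw [Finset.mem_Ioc] at hj
    rw [listCross_left_comm, map_smul, listMap_listMap, smul_smul, smul_smul]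
    have e : (graft₂ i j ∘ fun x : BracketingOf b × BracketingOf a × BracketingOf c =>
        (x.2.1, x.1, x.2.2)) = graft₂ (j + a - 1) i := by
      ext1 x
      have := graft_graft_disjoint i j x.2.1.1 x.1.1 x.2.2.1 hi.1 hj.1
        (by rw [x.2.2.2]; exact hj.2)
      rw [x.2.1.2] at this
      exact this
    rw [e]
    congr 1
    rw [← pow_add, ← pow_add, ← pow_add, ← pow_add, hu, hv]
    refine neg_one_pow_eq_of_cast_eq ?_
    obtain ⟨a, rfl⟩ := Nat.exists_eq_add_of_le' ha
    rw [show j + (a + 1) - 1 = j + a by omega]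
    push_cast
    generalize (a : ZMod 2) = a
    generalize (b : ZMod 2) = b
    generalize (i : ZMod 2) = i
    generalize (j : ZMod 2) = j
    generalize (p : ZMod 2) = p
    generalize (q : ZMod 2) = q
    generalize (r : ZMod 2) = r
    decide +revert
  · intro j i
    simp only [Finset.mem_Icc, Finset.mem_Ico, Finset.mem_Ioc]
    omega

/-- By `listPreLie_eq_add` the associator is the sum of the insertions at two different slots;
`sum_disjoint_swap` exchanges the two orders of the slots. The equations for `A`, `B`, `D` allow
chains of plain bracketings that lift to fixed lengths. -/
theorem listPreLie_associator {p q : ℕ} (ha : 1 ≤ a) (hb : 1 ≤ b) (r : ℕ)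
    {us : List (BracketingOf a)} {vs : List (BracketingOf b)} (hu : us.length = p + 1)
    (hv : vs.length = q + 1) (C : List (BracketingOf c) →₀ k) {A B D : List Bracketing →₀ k}
    (hA : A = listMap k Subtype.val (Finsupp.single us 1))
    (hB : B = listMap k Subtype.val (Finsupp.single vs 1)) (hD : D = listMap k Subtype.val C) :
    listPreLie k a (q + r) (b + c - 1) A (listPreLie k b r c B D) -
        listPreLie k (a + b - 1) r c (listPreLie k a q b A B) D =
      (-1 : k) ^ ((a + p + 1) * (b + q + 1)) •
        (listPreLie k b (p + r) (a + c - 1) B (listPreLie k a r c A D) -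
          listPreLie k (b + a - 1) r c (listPreLie k b p a B A) D) := by
  subst hA hB hD
  rw [listPreLie_eq_add ha hb, listPreLie_eq_add hb ha, add_sub_cancel_left, add_sub_cancel_left,
    sum_disjoint_swap ha r hu hv, sum_disjoint_swap hb r hv hu, smul_add, smul_smul,
    mul_comm (b + q + 1), ← mul_pow, add_comm]
  simp

end PreLie

/-! ### The Leibniz rule for `⋄` on chains of lists -/

section ListLeibniz

variable {k : Type*} [Field k] {V W : Type}

theorem listBoundary_listMap (f : V → W) (A : List V →₀ k) :
    listBoundary k (listMap k f A) = listMap k f (listBoundary k A) := by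
  induction A using Finsupp.induction_linear with
  | zero => simp
  | add A B hA hB => simp [hA, hB]
  | single l c =>
    rw [← mul_one c, ← smul_eq_mul, ← Finsupp.smul_single]
    simp only [map_smul]
    congr 1
    induction l with
    | nil => simp [listBoundaryAux]
    | cons v l ih =>
      simp only [listMap_single, listBoundary_single, List.map_cons, listBoundaryAux, map_sub,
        listMap_consMap] at ih ⊢
      rw [ih]

theorem nilCoeff_listMap (f : V → W) (A : List V →₀ k) :
    nilCoeff k (listMap k f A) = nilCoeff k A := by
  induction A using Finsupp.induction_linear with
  | zero => simp
  | add A B hA hB => simp [hA, hB]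
  | single l c => simp

theorem nilCoeff_listCross (A : List V →₀ k) (B : List W →₀ k) :
    nilCoeff k (listCross k A B) = 0 := by
  have : (listCross k (V := V) (W := W)).compr₂ (nilCoeff k) = 0 :=
    list_bilin_ext fun vs ws => by simp [nilCoeff_listCrossAux]
  exact LinearMap.congr_fun₂ this A B

variable (k) in
/-- Removal of the empty list from a chain of lists. -/
noncomputable def dropNil : (List V →₀ k) →ₗ[k] (List V →₀ k) :=
  LinearMap.id - (nilCoeff k).smulRight (Finsupp.single [] 1)

theorem dropNil_apply (A : List V →₀ k) :
    dropNil k A = A - nilCoeff k A • Finsupp.single [] 1 := rfl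

theorem listBoundary_dropNil (A : List V →₀ k) :
    listBoundary k (dropNil k A) = listBoundary k A := by
  simp [dropNil_apply, listBoundaryAux, -Finsupp.smul_single]

/-- `dropNil` discards exactly the augmentation term of `listBoundary_listCrossAux`, as products
contain no empty list. -/
theorem dropNil_listBoundary_listMap_listCross (f : V × W → U) {vs : List V} {ws : List W}
    (hv : vs ≠ []) (hw : ws ≠ []) :
    dropNil k (listBoundary k (listMap k f
        (listCross k (Finsupp.single vs 1) (Finsupp.single ws 1)))) =
      listMap k f (listCross k (listBoundary k (Finsupp.single vs 1)) (Finsupp.single ws 1)) +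
        (-1 : k) ^ (vs.length + 1) • listMap k f
          (listCross k (Finsupp.single vs 1) (listBoundary k (Finsupp.single ws 1))) := by
  obtain ⟨v, vs, rfl⟩ := List.exists_cons_of_ne_nil hv
  obtain ⟨w, ws, rfl⟩ := List.exists_cons_of_ne_nil hw
  rw [listBoundary_listMap, listCross_single, listBoundary_listCrossAux, dropNil_apply,
    nilCoeff_listMap, map_add (nilCoeff k), map_add (nilCoeff k), map_smul (nilCoeff k),
    nilCoeff_listCross, nilCoeff_listCross, map_add, map_add, map_smul, listBoundary_single,
    listBoundary_single, List.length_cons, pow_add, pow_add]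
  split_ifs <;> simp

theorem dropNil_listBoundary_listPreLie (a q b : ℕ) {us vs : List Bracketing} (hu : us ≠ [])
    (hv : vs ≠ []) :
    dropNil k (listBoundary k (listPreLie k a q b (Finsupp.single us 1) (Finsupp.single vs 1))) =
      listPreLie k a q b (listBoundary k (Finsupp.single us 1)) (Finsupp.single vs 1) +
        (-1 : k) ^ (us.length + 1) • listPreLie k a q b (Finsupp.single us 1)
          (listBoundary k (Finsupp.single vs 1)) := by
  simp only [listPreLie, LinearMap.sum_apply, LinearMap.smul_apply, LinearMap.compr₂_apply,
    map_sum, map_smul, Finset.smul_sum, ← Finset.sum_add_distrib,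
    dropNil_listBoundary_listMap_listCross _ hu hv, smul_add]
  refine Finset.sum_congr rfl fun t _ => ?_
  rw [smul_comm]

/-- Products with the empty list vanish, so inside `⋄` the augmented boundary and d_S are
interchangeable. -/
theorem listPreLie_dropNil_left (a q b : ℕ) (A B : List Bracketing →₀ k) :
    listPreLie k a q b (dropNil k A) B = listPreLie k a q b A B := by
  simp [listPreLie, dropNil_apply, listCross_nil_left, LinearMap.sum_apply]

theorem listPreLie_dropNil_right (a q b : ℕ) (A B : List Bracketing →₀ k) :
    listPreLie k a q b A (dropNil k B) = listPreLie k a q b A B := by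
  simp [listPreLie, dropNil_apply, listCross_nil_right, LinearMap.sum_apply]

/-- The origin of the factor (-1)^(a+1) that turns the topological sign (-1)^p into (-1)^|s|. -/
theorem listPreLie_succ (a q b : ℕ) (A B : List Bracketing →₀ k) :
    listPreLie k a (q + 1) b A B = (-1 : k) ^ (a + 1) • listPreLie k a q b A B := by
  simp only [listPreLie, LinearMap.sum_apply, LinearMap.smul_apply, Finset.smul_sum, smul_smul]
  refine Finset.sum_congr rfl fun t _ => ?_
  rw [← pow_add]
  congr 2
  ring

end ListLeibniz

/-! ### Transfer to C(K) -/

section Total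

variable (k : Type*) [Field k]

/-- The elements of `C(K)` as chains of lists. -/
noncomputable def totalToList : TotalChain k →ₗ[k] (List Bracketing →₀ k) :=
  DirectSum.toModule k (ℕ × ℕ) _ fun x => toListChain k (triang x.2) x.1

/-- The operation `⋄` on `C(K)`. -/
noncomputable def totalPreLie : TotalChain k →ₗ[k] TotalChain k →ₗ[k] TotalChain k :=
  bilinearOfSummands k fun p a q b => (preLie k p a q b).compr₂ (incl k (p + q) (a + b - 1))

variable {k}

@[simp] theorem totalToList_incl (p n : ℕ) (x : AssocChain k p n) :
    totalToList k (incl k p n x) = toListChain k (triang n) p x := by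
  simp [totalToList, incl]

theorem bilinearOfSummands_incl
    (F : ∀ p a q b : ℕ, AssocChain k p a →ₗ[k] AssocChain k q b →ₗ[k] TotalChain k) (p a q b : ℕ)
    (x : AssocChain k p a) (y : AssocChain k q b) :
    bilinearOfSummands k F (incl k p a x) (incl k q b y) = F p a q b x y := by
  simp [bilinearOfSummands, incl]

@[simp] theorem totalPreLie_incl (p a q b : ℕ) (x : AssocChain k p a) (y : AssocChain k q b) :
    totalPreLie k (incl k p a x) (incl k q b y) =
      incl k (p + q) (a + b - 1) (preLie k p a q b x y) :=
  bilinearOfSummands_incl _ p a q b x y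

@[simp] theorem dS_incl_zero (n : ℕ) (x : AssocChain k 0 n) : dS k (incl k 0 n x) = 0 := by
  simp [dS, incl]

@[simp] theorem dS_incl_succ (p n : ℕ) (x : AssocChain k (p + 1) n) :
    dS k (incl k (p + 1) n x) = incl k p n (boundary k (triang n) p x) := by
  simp [dS, incl]

theorem OSimplex.length_toList {n p : ℕ} (v : OSimplex (triang n) p) : v.toList.length = p + 1 :=
  List.length_ofFn

theorem OSimplex.two_le {n p : ℕ} (v : OSimplex (triang n) p) : 2 ≤ n := two_le_of_mem v.2.2

theorem OSimplex.length_of_mem_toList {n p : ℕ} (v : OSimplex (triang n) p) {u : Bracketing}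
    (hu : u ∈ v.toList) : u.length = n := by
  obtain ⟨i, rfl⟩ := (List.mem_ofFn' _ _).mp hu
  exact length_of_mem v.2.2 (Finset.mem_image_of_mem _ (Finset.mem_univ i))

theorem OSimplex.exists_lift {n p : ℕ} (v : OSimplex (triang n) p) :
    ∃ us : List (BracketingOf n), us.length = p + 1 ∧
      (Finsupp.single v.toList 1 : List Bracketing →₀ k) =
        listMap k Subtype.val (Finsupp.single us 1) := by
  refine ⟨v.toList.attachWith _ fun u hu => v.length_of_mem_toList hu, ?_, ?_⟩
  · simp [v.length_toList]
  · simp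

/-- The length of the list gives the dimension, and the length of any vertex gives `n`. -/
theorem toList_injective {x y : Σ x : ℕ × ℕ, OSimplex (triang x.2) x.1}
    (h : x.2.toList = y.2.toList) : x = y := by
  obtain ⟨⟨p, n⟩, v⟩ := x
  obtain ⟨⟨q, m⟩, w⟩ := y
  dsimp only at h v w
  obtain rfl : p = q := by
    have := congrArg List.length h
    rwa [v.length_toList, w.length_toList, Nat.add_right_cancel_iff] at this
  obtain rfl : n = m := by
    have hv : v.1 0 ∈ v.toList := (List.mem_ofFn' _ _).mpr ⟨0, rfl⟩
    rw [← v.length_of_mem_toList hv, w.length_of_mem_toList (h ▸ hv)]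
  have : v = w := Subtype.ext (List.ofFn_injective h)
  rw [this]

theorem totalToList_injective : Function.Injective (totalToList k) := by
  classical
  let inv : (List Bracketing →₀ k) →ₗ[k] TotalChain k := Finsupp.linearCombination k fun l =>
    if h : ∃ x : Σ x : ℕ × ℕ, OSimplex (triang x.2) x.1, x.2.toList = l then
      incl k h.choose.1.1 h.choose.1.2 (Finsupp.single h.choose.2 1) else 0
  have h : inv ∘ₗ totalToList k = LinearMap.id := by
    refine DirectSum.linearMap_ext k fun x => ?_
    ext1 v
    ext1
    change inv (totalToList k (incl k x.1 x.2 (Finsupp.single v 1))) =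
      incl k x.1 x.2 (Finsupp.single v 1)
    have hx : ∃ y : Σ x : ℕ × ℕ, OSimplex (triang x.2) x.1, y.2.toList = v.toList := ⟨⟨x, v⟩, rfl⟩
    have e : hx.choose = ⟨x, v⟩ := toList_injective hx.choose_spec
    simp only [inv, totalToList_incl, toListChain_single, Finsupp.linearCombination_single,
      one_smul, hx, dite_true]
    rw [e]
  exact Function.LeftInverse.injective (g := inv) fun x => LinearMap.congr_fun h x

theorem incl_mem_grading (p n : ℕ) (x : AssocChain k p n) : incl k p n x ∈ grading k (deg p n) :=
  le_iSup_of_le (f := fun p => ⨆ (n' : ℕ) (_ : deg p n' = deg _ _), LinearMap.range (incl k p n')) p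
    (le_iSup_of_le (f := fun n' => ⨆ (_ : deg p n' = deg _ _), LinearMap.range (incl k p n')) n
      (le_iSup_of_le rfl le_rfl)) ⟨x, rfl⟩

theorem incl_mem_grading_of_eq {p n : ℕ} {m : ℤ} (h : deg p n = m) (x : AssocChain k p n) :
    incl k p n x ∈ grading k m :=
  h ▸ incl_mem_grading p n x

-- Reduces linear statements on homogeneous elements to single oriented simplices.
@[elab_as_elim]
theorem grading_induction {m : ℤ} {P : ∀ x, x ∈ grading k m → Prop}
    (zero : P 0 (zero_mem _)) (add : ∀ x y hx hy, P x hx → P y hy → P (x + y) (add_mem hx hy))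
    (smul : ∀ (c : k) (x hx), P x hx → P (c • x) (Submodule.smul_mem _ c hx))
    (incl_single : ∀ p n (v : OSimplex (triang n) p) (h : deg p n = m),
      P (incl k p n (Finsupp.single v 1)) (incl_mem_grading_of_eq h _))
    {x : TotalChain k} (hx : x ∈ grading k m) : P x hx := by
  let S : Submodule k (TotalChain k) :=
    { carrier := {x | ∃ hx, P x hx}
      zero_mem' := ⟨_, zero⟩
      add_mem' := fun ⟨_, hx⟩ ⟨_, hy⟩ => ⟨_, add _ _ _ _ hx hy⟩
      smul_mem' := fun c _ ⟨_, hx⟩ => ⟨_, smul c _ _ hx⟩ }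
  suffices h : grading k m ≤ S from (h hx).2
  refine iSup_le fun p => iSup_le fun n => iSup_le fun h => ?_
  rintro _ ⟨y, rfl⟩
  induction y using Finsupp.induction_linear with
  | zero => rw [map_zero]; exact S.zero_mem
  | add y z hy hz => rw [map_add]; exact S.add_mem hy hz
  | single v c =>
    rw [← mul_one c, ← smul_eq_mul, ← Finsupp.smul_single, map_smul]
    exact S.smul_mem _ ⟨_, incl_single p n v h⟩

theorem negOnePow_smul {M : Type*} [AddCommGroup M] [Module k M] {m : ℤ} {n : ℕ}
    (h : Even (m - n)) (x : M) : m.negOnePow • x = (-1 : k) ^ n • x := by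
  rw [(Int.negOnePow_eq_iff m n).mpr h]
  rcases Nat.even_or_odd n with hn | hn
  · rw [Int.negOnePow_even _ (by exact_mod_cast hn), hn.neg_one_pow, one_smul, one_smul]
  · rw [Int.negOnePow_odd _ (by exact_mod_cast hn), hn.neg_one_pow, Units.neg_smul, one_smul,
      neg_smul, one_smul]

/-- In dimension 0 the augmented boundary is a multiple of the empty list, and d_S is 0; in positive
dimension no empty list occurs. -/
theorem totalToList_dS (x : TotalChain k) :
    totalToList k (dS k x) = dropNil k (listBoundary k (totalToList k x)) := by
  have : totalToList k ∘ₗ dS k = dropNil k ∘ₗ listBoundary k ∘ₗ totalToList k := by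
    refine DirectSum.linearMap_ext k fun y => LinearMap.ext fun c => ?_
    obtain ⟨p, n⟩ := y
    change totalToList k (dS k (incl k p n c)) =
      dropNil k (listBoundary k (totalToList k (incl k p n c)))
    cases p with
    | zero =>
      obtain ⟨d, hd⟩ := listBoundary_toListChain_zero c
      rw [dS_incl_zero, totalToList_incl, hd, dropNil_apply]
      simp
    | succ p =>
      rw [dS_incl_succ, totalToList_incl, totalToList_incl, toListChain_boundary, dropNil_apply]
      have h : nilCoeff k (toListChain k (triang n) p (boundary k (triang n) p c)) = 0 := by
        generalize boundary k (triang n) p c = c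
        induction c using Finsupp.induction_linear with
        | zero => simp
        | add y z hy hz => simp [hy, hz]
        | single v c => simp [OSimplex.toList]
      rw [toListChain_boundary] at h
      rw [h, zero_smul, sub_zero]
  exact LinearMap.congr_fun this x

theorem dS_dS (x : TotalChain k) : dS k (dS k x) = 0 := by
  refine totalToList_injective ?_
  rw [totalToList_dS, totalToList_dS, listBoundary_dropNil, listBoundary_listBoundary, map_zero,
    map_zero]

/-- The bound keeps `a + b - 1` from truncating; it holds whenever K_a has a simplex. -/
theorem deg_preLie {p a q b : ℕ} (ha : 2 ≤ a) :
    deg (p + q) (a + b - 1) = deg p a + deg q b := by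
  unfold deg
  omega

variable {i j l : ℤ} {x y z : TotalChain k}

theorem totalPreLie_mem (hx : x ∈ grading k i) (hy : y ∈ grading k j) :
    totalPreLie k x y ∈ grading k (i + j) := by
  induction hx using grading_induction with
  | zero => simp
  | add x x' _ _ h h' => rw [map_add]; exact add_mem h h'
  | smul c x _ h => rw [map_smul]; exact Submodule.smul_mem _ _ h
  | incl_single p a v hi =>
    induction hy using grading_induction with
    | zero => simp
    | add x x' _ _ h h' => rw [map_add]; exact add_mem h h'
    | smul c x _ h => rw [map_smul]; exact Submodule.smul_mem _ _ h
    | incl_single q b w hj =>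
      rw [totalPreLie_incl]
      exact incl_mem_grading_of_eq (by rw [deg_preLie v.two_le, hi, hj]) _

theorem dS_mem (hx : x ∈ grading k i) : dS k x ∈ grading k (i + 1) := by
  induction hx using grading_induction with
  | zero => simp
  | add x x' _ _ h h' => rw [map_add]; exact add_mem h h'
  | smul c x _ h => rw [map_smul]; exact Submodule.smul_mem _ _ h
  | incl_single p a v hi =>
    cases p with
    | zero => simp
    | succ p =>
      rw [dS_incl_succ]
      refine incl_mem_grading_of_eq ?_ _
      unfold deg at *
      omega

theorem totalPreLie_associator (hx : x ∈ grading k i) (hy : y ∈ grading k j)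
    (hz : z ∈ grading k l) :
    totalPreLie k x (totalPreLie k y z) - totalPreLie k (totalPreLie k x y) z =
      (i * j).negOnePow • (totalPreLie k y (totalPreLie k x z) -
        totalPreLie k (totalPreLie k y x) z) := by
  induction hx using grading_induction with
  | zero => simp
  | add x x' _ _ h h' =>
    simp only [map_add, LinearMap.add_apply]
    rw [add_sub_add_comm, h, h', add_sub_add_comm, smul_add]
  | smul c x _ h =>
    simp only [map_smul, LinearMap.smul_apply]
    rw [← smul_sub, h, ← smul_sub, smul_comm]
  | incl_single p a v hi =>
    induction hy using grading_induction with
    | zero => simp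
    | add x x' _ _ h h' =>
      simp only [map_add, LinearMap.add_apply]
      rw [add_sub_add_comm, h, h', add_sub_add_comm, smul_add]
    | smul c x _ h =>
      simp only [map_smul, LinearMap.smul_apply]
      rw [← smul_sub, h, ← smul_sub, smul_comm]
    | incl_single q b w hj =>
      induction hz using grading_induction with
      | zero => simp
      | add x x' _ _ h h' =>
        simp only [map_add]
        rw [add_sub_add_comm, h, h', add_sub_add_comm, smul_add]
      | smul c x _ h =>
        simp only [map_smul]
        rw [← smul_sub, h, ← smul_sub, smul_comm]
      | incl_single r c u _ =>
        -- `i = a - p - 1` has the parity of `a + p + 1`, and `j` that of `b + q + 1`.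
        have hsign : Even (i * j - ((a + p + 1) * (b + q + 1) : ℕ)) := by
          rw [← hi, ← hj]
          unfold deg
          push_cast
          refine ⟨-((p + 1) * b + (q + 1) * a), ?_⟩
          ring
        rw [negOnePow_smul (k := k) hsign]
        obtain ⟨vs, hvs, ev⟩ := v.exists_lift (k := k)
        obtain ⟨ws, hws, ew⟩ := w.exists_lift (k := k)
        obtain ⟨us, hus, eu⟩ := u.exists_lift (k := k)
        refine totalToList_injective ?_
        have ha := v.two_le
        have hb := w.two_le
        simp only [totalPreLie_incl, map_sub, map_smul, totalToList_incl, toListChain_preLie,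
          toListChain_single]
        exact listPreLie_associator (by omega) (by omega) r hvs hws _ ev ew eu

theorem dS_totalPreLie (hx : x ∈ grading k i) (hy : y ∈ grading k j) :
    dS k (totalPreLie k x y) =
      totalPreLie k (dS k x) y + i.negOnePow • totalPreLie k x (dS k y) := by
  induction hx using grading_induction with
  | zero => simp
  | add x x' _ _ h h' =>
    simp only [map_add, LinearMap.add_apply]
    rw [h, h', add_add_add_comm, smul_add]
  | smul c x _ h =>
    simp only [map_smul, LinearMap.smul_apply]
    rw [h, smul_add, smul_comm]
  | incl_single p a v hi =>
    induction hy using grading_induction with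
    | zero => simp
    | add x x' _ _ h h' =>
      simp only [map_add]
      rw [h, h', add_add_add_comm, smul_add]
    | smul c x _ h =>
      simp only [map_smul]
      rw [h, smul_add, smul_comm]
    | incl_single q b w hj =>
      have hsign : Even (i - (a + p + 1 : ℕ)) := by
        rw [← hi]
        unfold deg
        push_cast
        exact ⟨-(p + 1), by ring⟩
      rw [negOnePow_smul (k := k) hsign]
      refine totalToList_injective ?_
      have hl : totalToList k (totalPreLie k (dS k (incl k p a (Finsupp.single v 1)))
          (incl k q b (Finsupp.single w 1))) = listPreLie k a q b
            (listBoundary k (Finsupp.single v.toList 1)) (Finsupp.single w.toList 1) := by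
        rw [← listPreLie_dropNil_left, ← toListChain_single v, ← totalToList_incl,
          ← totalToList_dS]
        cases p with
        | zero => simp
        | succ p => simp [toListChain_preLie]
      -- For `q > 0` the differential lowers the second dimension to `q - 1`, so the signs of `⋄`
      -- change by (-1)^(a+1).
      have hr : totalToList k (totalPreLie k (incl k p a (Finsupp.single v 1))
          (dS k (incl k q b (Finsupp.single w 1)))) = (-1 : k) ^ (a + 1) • listPreLie k a q b
            (Finsupp.single v.toList 1) (listBoundary k (Finsupp.single w.toList 1)) := by
        rw [← listPreLie_dropNil_right, ← toListChain_single w, ← totalToList_incl,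
          ← totalToList_dS]
        cases q with
        | zero => simp
        | succ q =>
          rw [listPreLie_succ, smul_smul, ← mul_pow]
          simp [toListChain_preLie]
      have hne : ∀ {n m : ℕ} (s : OSimplex (triang n) m), s.toList ≠ [] := fun s h => by
        have := s.length_toList
        rw [h] at this
        simp at this
      rw [totalToList_dS, totalPreLie_incl, totalToList_incl, toListChain_preLie,
        toListChain_single, toListChain_single, dropNil_listBoundary_listPreLie _ _ _ (hne v) (hne w),
        map_add, map_smul, hl, hr, v.length_toList, smul_smul, ← pow_add]
      congr 2
      refine neg_one_pow_congr ?_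
      simp only [Nat.even_add, Nat.even_add_one]
      tauto

/-! ### The identities for the graded commutator -/

theorem bracket_eq (hx : x ∈ grading k i) (hy : y ∈ grading k j) :
    bracket k x y = totalPreLie k x y - (i * j).negOnePow • totalPreLie k y x := by
  induction hx using grading_induction with
  | zero => simp
  | add x x' _ _ h h' =>
    simp only [map_add, LinearMap.add_apply]
    rw [h, h', sub_add_sub_comm, smul_add]
  | smul c x _ h =>
    simp only [map_smul, LinearMap.smul_apply]
    rw [h, smul_sub, smul_comm]
  | incl_single p a v hi =>
    induction hy using grading_induction with
    | zero => simp
    | add x x' _ _ h h' =>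
      simp only [map_add, LinearMap.add_apply]
      rw [h, h', sub_add_sub_comm, smul_add]
    | smul c x _ h =>
      simp only [map_smul, LinearMap.smul_apply]
      rw [h, smul_sub, smul_comm]
    | incl_single q b w hj =>
      rw [bracket, bilinearOfSummands_incl, totalPreLie_incl, totalPreLie_incl, hi, hj]
      rfl

theorem bracket_mem_grading (hx : x ∈ grading k i) (hy : y ∈ grading k j) :
    bracket k x y ∈ grading k (i + j) := by
  rw [bracket_eq hx hy]
  refine sub_mem (totalPreLie_mem hx hy) ?_
  have := totalPreLie_mem hy hx
  rw [add_comm] at this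
  rcases Int.units_eq_one_or (i * j).negOnePow with h | h <;> rw [h]
  · rwa [one_smul]
  · rw [Units.neg_smul, one_smul]
    exact neg_mem this

theorem bracket_skew (hx : x ∈ grading k i) (hy : y ∈ grading k j) :
    bracket k x y = -((i * j).negOnePow • bracket k y x) := by
  rw [bracket_eq hx hy, bracket_eq hy hx, mul_comm j]
  rcases Int.units_eq_one_or (i * j).negOnePow with h | h <;> rw [h] <;>
    simp only [Units.neg_smul, one_smul] <;> abel

theorem bracket_jacobi (hx : x ∈ grading k i) (hy : y ∈ grading k j) (hz : z ∈ grading k l) :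
    bracket k x (bracket k y z) =
      bracket k (bracket k x y) z + (i * j).negOnePow • bracket k y (bracket k x z) := by
  rw [bracket_eq hx (bracket_mem_grading hy hz), bracket_eq (bracket_mem_grading hx hy) hz,
    bracket_eq hy (bracket_mem_grading hx hz), bracket_eq hy hz, bracket_eq hx hy,
    bracket_eq hx hz]
  -- The expanded Jacobi identity is a combination of three symmetries of the associator, one for
  -- each pair among `x`, `y`, `z`. Relative to `h1`, the coefficient of `h2` is -(-1)^(jl) and that
  -- of `h3` is (-1)^(ij+il), hence the four alternatives below.
  have h1 := totalPreLie_associator hx hy hz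
  have h2 := totalPreLie_associator hx hz hy
  have h3 := totalPreLie_associator hy hz hx
  simp only [mul_add, add_mul, Int.negOnePow_add]
  rw [mul_comm j i]
  rcases Int.units_eq_one_or (i * j).negOnePow with e1 | e1 <;>
  rcases Int.units_eq_one_or (i * l).negOnePow with e2 | e2 <;>
  rcases Int.units_eq_one_or (j * l).negOnePow with e3 | e3 <;>
  rw [e1] at h1 ⊢ <;> rw [e2] at h2 ⊢ <;> rw [e3] at h3 ⊢ <;>
  simp only [mul_one, mul_neg, neg_neg, Units.neg_smul, one_smul, sub_neg_eq_add, map_sub,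
    map_add, LinearMap.sub_apply, LinearMap.add_apply] at h1 h2 h3 ⊢ <;>
  first
    | linear_combination (norm := abel1) h1 - h2 + h3
    | linear_combination (norm := abel1) h1 - h2 - h3
    | linear_combination (norm := abel1) h1 + h2 + h3
    | linear_combination (norm := abel1) h1 + h2 - h3

theorem dS_bracket (hx : x ∈ grading k i) (hy : y ∈ grading k j) :
    dS k (bracket k x y) = bracket k (dS k x) y + i.negOnePow • bracket k x (dS k y) := by
  rw [bracket_eq hx hy, bracket_eq (dS_mem hx) hy, bracket_eq hx (dS_mem hy), map_sub,
    dS_totalPreLie hx hy]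
  have h := dS_totalPreLie hy hx
  simp only [mul_add, add_mul, Int.negOnePow_add, mul_one, one_mul]
  rcases Int.units_eq_one_or (i * j).negOnePow with e1 | e1 <;>
  rcases Int.units_eq_one_or i.negOnePow with e2 | e2 <;>
  rcases Int.units_eq_one_or j.negOnePow with e3 | e3 <;>
  rw [e1, e2, e3] <;> rw [e3] at h <;>
  simp only [mul_one, mul_neg, neg_neg, Units.neg_smul, one_smul, sub_neg_eq_add,
    map_neg, h] <;> abel

/-- The grading coarsens the decomposition by pairs `(p, n)`: each summand lies in the single degree
`deg p n`, which defines the inverse `dec` of the sum map. -/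
theorem isInternal_grading : DirectSum.IsInternal (grading k) := by
  let dec : TotalChain k →ₗ[k] ⨁ m, grading k m :=
    DirectSum.toModule k (ℕ × ℕ) _ fun x =>
      DirectSum.lof k ℤ (fun m => grading k m) (deg x.1 x.2) ∘ₗ
        (incl k x.1 x.2).codRestrict (grading k (deg x.1 x.2)) (incl_mem_grading x.1 x.2)
  have hdec : ∀ p n (c : AssocChain k p n), dec (incl k p n c) =
      DirectSum.lof k ℤ (fun m => grading k m) (deg p n) ⟨_, incl_mem_grading p n c⟩ := by
    intro p n c
    simp only [dec, incl, DirectSum.toModule_lof]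
    rfl
  -- The form for a degree that is only propositionally `deg p n`, as it occurs in
  -- `grading_induction`.
  have hdec' : ∀ {m p n} (h : deg p n = m) (c : AssocChain k p n), dec (incl k p n c) =
      DirectSum.lof k ℤ (fun m => grading k m) m ⟨_, incl_mem_grading_of_eq h c⟩ := by
    rintro _ p n rfl c
    exact hdec p n c
  let D : DirectSum.Decomposition (grading k) := DirectSum.Decomposition.ofLinearMap _ dec
    (by
      refine DirectSum.linearMap_ext k fun x => LinearMap.ext fun c => ?_
      change DirectSum.coeLinearMap (grading k) (dec (incl k x.1 x.2 c)) = incl k x.1 x.2 c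
      rw [hdec, DirectSum.coeLinearMap_lof])
    (by
      refine DirectSum.linearMap_ext k fun m => LinearMap.ext fun ⟨c, hc⟩ => ?_
      change dec (DirectSum.coeLinearMap (grading k)
        (DirectSum.lof k ℤ (fun m => grading k m) m ⟨c, hc⟩)) =
          DirectSum.lof k ℤ (fun m => grading k m) m ⟨c, hc⟩
      rw [DirectSum.coeLinearMap_lof]
      change dec c = _
      induction hc using grading_induction with
      | zero => rw [map_zero]; exact (map_zero _).symm
      | add x y hx hy h h' => rw [map_add, h, h', ← map_add]; rfl
      | smul c x hx h => rw [map_smul, h, ← map_smul]; rfl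
      | incl_single p n v h => exact hdec' h _)
  exact D.isInternal

end Total

end Associahedron

theorem mainTheorem3 (k : Type*) [Field k] [CharZero k] :
    Associahedron.IsDGLieAlgebra k (Associahedron.grading k) (Associahedron.bracket k)
      (Associahedron.dS k) where
  isInternal := Associahedron.isInternal_grading
  bracket_mem := Associahedron.bracket_mem_grading
  d_mem := Associahedron.dS_mem
  skew := Associahedron.bracket_skew
  jacobi := Associahedron.bracket_jacobi
  d_d := Associahedron.dS_dS
  leibniz := Associahedron.dS_bracket
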